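/- Let $m>1$. For $\sigma>0$ put $\alpha=\dfrac{\sigma+2}{\sigma(m-1)}$, $\beta=\dfrac1\sigma$, and consider the profile equation $$(f^m)''(\xi)-\alpha f(\xi)+\beta\xi f'(\xi)+\xi^\sigma f(\xi)=0,\qquad \xi\in[0,\infty). \tag{1}$$ A solution of (1) is a continuous function $f:[0,\infty)\to[0,\infty)$ such that $f^m\in C^1([0,\infty))$, equation (1) holds in the classical sense at every point where $f>0$, and the flux $(f^m)'+\beta\xi f$ is differentiable on $[0,\infty)$ with derivative $(\alpha+\beta-\xi^\sigma)f$ (derivatives at $\xi=0$ are one-sided). A solution $f$ is a good profile if either (P1) $f(0)>0$ and $f'(0)=0$, or (P2) $f(0)=0$ and $(f^m)'(0)=0$. A good profile $f$ is a good profile with interface if there are $\xi_1\in(0,\infty)$ and $\delta\in(0,\xi_1]$ with $f(\xi_1)=0$, $(f^m)'(\xi_1)=0$ and $f>0$ on $(\xi_1-\delta,\xi_1)$. **Theorem.** For every $m>1$ and every $\sigma>0$ there exists at least one good profile with interface for (1). Moreover, for $\sigma=\sigma_*:=\sqrt{2(m+1)}$, the function $$f_*(\xi)=\xi^{2/(m-1)}\left(\frac{m-1}{2m(m+1)}-B\xi^{\sigma_*}\right)_+^{1/(m-1)},\qquad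 B=\frac{(m-1)^2}{m(\sigma_*+2)(m\sigma_*+m+1)},$$ is a good profile with interface satisfying (P2). -/

import Mathlib

open Set

/-- The self-similar exponent `α = (σ + 2) / (σ (m - 1))`. -/
noncomputable def alphaExp (m σ : ℝ) : ℝ := (σ + 2) / (σ * (m - 1))

/-- The self-similar exponent `β = 1 / σ`. -/
noncomputable def betaExp (σ : ℝ) : ℝ := 1 / σ

/-- The derivative `(f^m)'` on the half-line `[0, ∞)` (one-sided at `0`). -/
noncomputable def powDeriv (m : ℝ) (f : ℝ → ℝ) (ξ : ℝ) : ℝ :=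
  derivWithin (fun x => f x ^ m) (Ici 0) ξ

/-- `f` is a (nonnegative) profile, that is, a solution of
`(f^m)'' - α f + β ξ f' + ξ^σ f = 0` on `[0, ∞)`.

As usual for a degenerate equation, the solution may vanish, and it need not be differentiable at
its zeros. The equation holds pointwise wherever `f > 0`. Across the zeros of `f` it holds in
conservation form: `f^m` is continuously differentiable and the flux `(f^m)' + β ξ f` is
differentiable with derivative `(α + β - ξ^σ) f`. All derivatives are taken on `[0, ∞)`, so they
are ordinary derivatives at `ξ > 0` and right derivatives at `ξ = 0`. Values of `f` at negative
arguments play no role. -/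
structure IsProfile (m σ : ℝ) (f : ℝ → ℝ) : Prop where
  nonneg : ∀ ξ, 0 ≤ ξ → 0 ≤ f ξ
  continuousOn : ContinuousOn f (Ici 0)
  contDiffOn_pow : ContDiffOn ℝ 1 (fun x => f x ^ m) (Ici 0)
  equation : ∀ ξ, 0 ≤ ξ → 0 < f ξ →
    DifferentiableWithinAt ℝ f (Ici 0) ξ ∧
    DifferentiableWithinAt ℝ (powDeriv m f) (Ici 0) ξ ∧
    derivWithin (powDeriv m f) (Ici 0) ξ - alphaExp m σ * f ξ
      + betaExp σ * ξ * derivWithin f (Ici 0) ξ + ξ ^ σ * f ξ = 0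
  flux : ∀ ξ, 0 ≤ ξ →
    HasDerivWithinAt (fun x => powDeriv m f x + betaExp σ * x * f x)
      ((alphaExp m σ + betaExp σ - ξ ^ σ) * f ξ) (Ici 0) ξ

/-- The initial behavior (P1): `f(0) > 0` and `f'(0) = 0`. -/
def SatisfiesP1 (f : ℝ → ℝ) : Prop :=
  0 < f 0 ∧ HasDerivWithinAt f 0 (Ici 0) 0

/-- The initial behavior (P2): `f(0) = 0` and `(f^m)'(0) = 0`. -/
def SatisfiesP2 (m : ℝ) (f : ℝ → ℝ) : Prop :=
  f 0 = 0 ∧ HasDerivWithinAt (fun x => f x ^ m) 0 (Ici 0) 0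

/-- A good profile: a solution of the profile equation with property (P1) or (P2). -/
def IsGoodProfile (m σ : ℝ) (f : ℝ → ℝ) : Prop :=
  IsProfile m σ f ∧ (SatisfiesP1 f ∨ SatisfiesP2 m f)

/-- `f` has an interface at `ξ₁`: `f(ξ₁) = 0`, `(f^m)'(ξ₁) = 0`, and `f > 0` on a left
neighborhood `(ξ₁ - δ, ξ₁)` contained in the half-line. -/
def HasInterfaceAt (m : ℝ) (f : ℝ → ℝ) (ξ₁ : ℝ) : Prop :=
  f ξ₁ = 0 ∧ HasDerivAt (fun x => f x ^ m) 0 ξ₁ ∧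
    ∃ δ, 0 < δ ∧ δ ≤ ξ₁ ∧ ∀ ξ ∈ Ioo (ξ₁ - δ) ξ₁, 0 < f ξ

/-- A good profile with interface at some point of `(0, ∞)`. -/
def IsGoodProfileWithInterface (m σ : ℝ) (f : ℝ → ℝ) : Prop :=
  IsGoodProfile m σ f ∧ ∃ ξ₁, 0 < ξ₁ ∧ HasInterfaceAt m f ξ₁

/-- The special exponent `σ_* = √(2 (m + 1))`. -/
noncomputable def sigmaStar (m : ℝ) : ℝ := Real.sqrt (2 * (m + 1))

/-- The constant `B = (m - 1)² / (m (σ_* + 2) (m σ_* + m + 1))`. -/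
noncomputable def constB (m : ℝ) : ℝ :=
  (m - 1) ^ 2 / (m * (sigmaStar m + 2) * (m * sigmaStar m + m + 1))

/-- The explicit profile
`f_*(ξ) = ξ^{2/(m-1)} ((m - 1) / (2 m (m + 1)) - B ξ^{σ_*})_+^{1/(m-1)}`. -/
noncomputable def fStar (m : ℝ) (ξ : ℝ) : ℝ :=
  ξ ^ (2 / (m - 1)) *
    (max ((m - 1) / (2 * m * (m + 1)) - constB m * ξ ^ sigmaStar m) 0) ^ (1 / (m - 1))

/-! The existence proof is a backward shooting from the interface. With `ξ = R (1 - s)`, `f = c W ^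
(1/m)` and `c ^ (m - 1) = R ^ 2`, the conservation form of (1) becomes `W' = b (1 - s) W ^ θ - G`,
`G' = (lam (1 - s) ^ σ - a) W ^ θ` on `[0, 1]`, where `θ = 1/m`, `a = α + β`, `b = β`, `lam = R ^
σ`, and `G` is the rescaled flux. An interface at `R` means `W 0 = G 0 = 0`. The condition `G 1 = 0`
says `(f^m)'(0) = 0`, which gives (P1) or (P2) according to whether `f 0` is positive. So the
unknown is the single number `lam`.

Since `W ^ θ` is not Lipschitz at `0`, the zero solution also starts at the interface. The power is
therefore replaced by `regPow` and the start by `W 0 = δ`. Then `G 1` depends continuously on `lam`.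
At `lam = a` the flux decreases, so `G 1 ≤ 0`. For large `lam`, `IsShot.final_flux_nonneg` gives `G
1 ≥ 0`: the flux grows so fast that it drives `W` to zero before `s = 1/2`, after which the
regularized nonlinearity vanishes and the flux is frozen. The intermediate value theorem gives a
shot with `G 1 = 0`.

All bounds are uniform in `δ` (`exists_uniform_isShot`), so Arzelà–Ascoli yields a limit as `δ → 0`.
The lower bound `W ^ (1 - θ) ≥ const * s` of `IsShot.le_of_small` survives the limit and excludes
the zero solution. `isProfile_of_hasDerivWithinAt` turns the first order system back into a profile.

For `σ_*` the function and its flux are explicit, and the same criterion reduces the claim to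
algebra, where `σ_* ^ 2 = 2 (m + 1)` enters. -/

open Filter Topology NNReal

/-! ### The regularized power -/

/-- A bounded Lipschitz regularization of `w ↦ (max w 0) ^ θ`: linear on `[0, δ]`, equal to
`w ^ θ` on `[δ, N]`, and constant outside `[0, N]`. -/
noncomputable def regPow (θ δ N w : ℝ) : ℝ :=
  (min (max w δ) N) ^ θ - δ ^ θ + δ ^ (θ - 1) * min (max w 0) δ

section RegPow

variable {θ δ N : ℝ}

theorem regPow_of_nonpos (hδ : 0 < δ) (hδN : δ ≤ N) {w : ℝ} (hw : w ≤ 0) :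
    regPow θ δ N w = 0 := by
  unfold regPow
  rw [max_eq_right (hw.trans hδ.le), max_eq_right hw, min_eq_left hδN, min_eq_left hδ.le]
  ring

theorem regPow_of_le (hδN : δ ≤ N) {w : ℝ} (hw : 0 ≤ w) (hwδ : w ≤ δ) :
    regPow θ δ N w = δ ^ (θ - 1) * w := by
  unfold regPow
  rw [max_eq_right hwδ, max_eq_left hw, min_eq_left hδN, min_eq_left hwδ]
  ring

theorem regPow_of_ge (hδ : 0 < δ) {w : ℝ} (hwδ : δ ≤ w) (hwN : w ≤ N) :
    regPow θ δ N w = w ^ θ := by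
  unfold regPow
  rw [max_eq_left hwδ, max_eq_left (hδ.le.trans hwδ), min_eq_left hwN, min_eq_right hwδ,
    Real.rpow_sub_one hδ.ne']
  field_simp
  ring

theorem regPow_monotone (hθ : 0 < θ) (hδ : 0 < δ) (hδN : δ ≤ N) : Monotone (regPow θ δ N) := by
  intro x y hxy
  unfold regPow
  have h0 : 0 ≤ min (max x δ) N := le_min (hδ.le.trans (le_max_right _ _)) (hδ.le.trans hδN)
  gcongr

theorem regPow_nonneg (hθ : 0 < θ) (hδ : 0 < δ) (hδN : δ ≤ N) (w : ℝ) : 0 ≤ regPow θ δ N w := by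
  have h := regPow_monotone hθ hδ hδN (min_le_left w 0)
  rwa [regPow_of_nonpos hδ hδN (min_le_right w 0)] at h

theorem regPow_le_rpow (hθ : 0 < θ) (hθ1 : θ < 1) (hδ : 0 < δ) (hδN : δ ≤ N) {w : ℝ}
    (hw : 0 ≤ w) : regPow θ δ N w ≤ w ^ θ := by
  rcases le_total w δ with h | h
  · rw [regPow_of_le hδN hw h]
    rcases hw.eq_or_lt with rfl | hw0
    · simp [Real.zero_rpow hθ.ne']
    · calc δ ^ (θ - 1) * w ≤ w ^ (θ - 1) * w := by
            gcongr ?_ * w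
            exact Real.rpow_le_rpow_of_nonpos hw0 h (by linarith)
        _ = w ^ θ := by rw [Real.rpow_sub_one hw0.ne']; field_simp
  · rcases le_total w N with h' | h'
    · rw [regPow_of_ge hδ h h']
    · unfold regPow
      rw [max_eq_left h, max_eq_left hw, min_eq_right h', min_eq_right h,
        Real.rpow_sub_one hδ.ne']
      have : N ^ θ ≤ w ^ θ := Real.rpow_le_rpow (hδ.le.trans hδN) h' hθ.le
      have h3 : δ ^ θ / δ * δ = δ ^ θ := by field_simp
      linarith

theorem regPow_le (hθ : 0 < θ) (hδ : 0 < δ) (hδN : δ ≤ N) (w : ℝ) :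
    regPow θ δ N w ≤ N ^ θ := by
  have h := regPow_monotone hθ hδ hδN (le_max_left w N)
  refine h.trans ?_
  have hN : N ≤ max w N := le_max_right w N
  unfold regPow
  rw [max_eq_left (hδN.trans hN), min_eq_right hN, max_eq_left (hδ.le.trans (hδN.trans hN)),
    min_eq_right (hδN.trans hN), Real.rpow_sub_one hδ.ne']
  have h3 : δ ^ θ / δ * δ = δ ^ θ := by field_simp
  linarith

/-- Splitting `w = w ^ (1 - θ) * w ^ θ`, with `δ` in place of `w` in the first factor on the linear
piece. For small `w` and `δ` the factor is small, so `W` is controlled by a small multiple of `f`.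
-/
theorem le_mul_regPow (hθ1 : θ < 1) (hδ : 0 < δ) (hδN : δ ≤ N) {w : ℝ}
    (hw : 0 ≤ w) (hwN : w ≤ N) : w ≤ max (w ^ (1 - θ)) (δ ^ (1 - θ)) * regPow θ δ N w := by
  rcases le_total w δ with h | h
  · rw [regPow_of_le hδN hw h, max_eq_right (Real.rpow_le_rpow hw h (by linarith)), ← mul_assoc,
      ← Real.rpow_add hδ]
    simp
  · have hw0 := hδ.trans_le h
    rw [regPow_of_ge hδ h hwN, max_eq_left (Real.rpow_le_rpow hδ.le h (by linarith)),
      ← Real.rpow_add hw0]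
    simp

/-- Uniform convergence to `w ^ θ` as `δ → 0`, needed to pass to the limit in the nonlinearity. -/
theorem abs_regPow_sub_le (hθ : 0 < θ) (hθ1 : θ < 1) (hδ : 0 < δ) (hδN : δ ≤ N) {w : ℝ}
    (hw : 0 ≤ w) (hwN : w ≤ N) : |regPow θ δ N w - w ^ θ| ≤ δ ^ θ := by
  rcases le_total w δ with h | h
  · rw [abs_sub_comm, abs_of_nonneg (sub_nonneg.2 (regPow_le_rpow hθ hθ1 hδ hδN hw))]
    have h1 := regPow_nonneg hθ hδ hδN w
    have h2 : w ^ θ ≤ δ ^ θ := Real.rpow_le_rpow hw h hθ.le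
    linarith
  · rw [regPow_of_ge hδ h hwN]
    simpa using Real.rpow_nonneg hδ.le θ

theorem exists_lipschitzWith_regPow (hδ : 0 < δ) (hδN : δ ≤ N) :
    ∃ K : ℝ≥0, LipschitzWith K (regPow θ δ N) := by
  have h1 : ∃ K : ℝ≥0, LipschitzOnWith K (fun x : ℝ => x ^ θ) (Icc δ N) := by
    have hd : ContDiffOn ℝ 1 (fun x : ℝ => x ^ θ) (Icc δ N) := fun x hx =>
      (Real.contDiffAt_rpow_const_of_ne (hδ.trans_le hx.1).ne').contDiffWithinAt
    exact hd.exists_lipschitzOnWith one_ne_zero (convex_Icc δ N) isCompact_Icc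
  obtain ⟨K, hK⟩ := h1
  have h2 : LipschitzWith 1 (fun w : ℝ => min (max w δ) N) :=
    (LipschitzWith.id.max_const δ).min_const N
  have h3 : LipschitzWith (K * 1) (fun w : ℝ => (min (max w δ) N) ^ θ) := by
    rw [← lipschitzOnWith_univ] at h2 ⊢
    exact hK.comp h2 fun w _ => ⟨le_min (le_max_right _ _) hδN, min_le_right _ _⟩
  have h4 : LipschitzWith 1 (fun w : ℝ => min (max w 0) δ) :=
    (LipschitzWith.id.max_const 0).min_const δ
  have h5 := (lipschitzWith_smul (δ ^ (θ - 1))).comp h4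
  exact ⟨_, (h3.sub (LipschitzWith.const (δ ^ θ))).add h5⟩

end RegPow

/-! ### Solvability of the regularized system -/

/-- Global solvability of `W' = c₁ g(W) - G`, `G' = c₂ g(W)` on `[0, 1]`. -/
theorem exists_solution_of_bounded_lipschitz {c₁ c₂ g : ℝ → ℝ} {C₁ C₂ B : ℝ} {K : ℝ≥0}
    (hc₁ : Continuous c₁) (hc₂ : Continuous c₂) (hC₁ : ∀ t, |c₁ t| ≤ C₁) (hC₂ : ∀ t, |c₂ t| ≤ C₂)
    (hg : LipschitzWith K g) (hB : ∀ w, |g w| ≤ B) (w₀ : ℝ) :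
    ∃ W G : ℝ → ℝ, W 0 = w₀ ∧ G 0 = 0 ∧
      (∀ s ∈ Icc (0 : ℝ) 1, HasDerivAt W (c₁ s * g (W s) - G s) s) ∧
      ∀ s ∈ Icc (0 : ℝ) 1, HasDerivAt G (c₂ s * g (W s)) s := by
  have hC₁0 : 0 ≤ C₁ := (abs_nonneg _).trans (hC₁ 0)
  have hC₂0 : 0 ≤ C₂ := (abs_nonneg _).trans (hC₂ 0)
  have hB0 : 0 ≤ B := (abs_nonneg _).trans (hB 0)
  -- The term `-G` is unbounded, so `G` is truncated at the a priori bound `C` for the flux on `[0,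
  -- 1]`. The truncation turns out to be inactive there.
  set C := C₂ * B with hC
  have hC0 : 0 ≤ C := by positivity
  set cl : ℝ → ℝ := fun q => min (max q (-C)) C with hcl
  have hclL : LipschitzWith 1 cl := (LipschitzWith.id.max_const (-C)).min_const C
  have hclB : ∀ q, |cl q| ≤ C := fun q =>
    abs_le.2 ⟨le_min (le_max_right _ _) (by linarith), min_le_right _ _⟩
  set v : ℝ → ℝ × ℝ → ℝ × ℝ := fun t x => (c₁ t * g x.1 - cl x.2, c₂ t * g x.1) with hv
  have hgx : LipschitzWith K (fun x : ℝ × ℝ => g x.1) := by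
    have h := hg.comp (LipschitzWith.prod_fst (α := ℝ) (β := ℝ))
    rwa [mul_one] at h
  have hclx : LipschitzWith 1 (fun x : ℝ × ℝ => cl x.2) := by
    have h := hclL.comp (LipschitzWith.prod_snd (α := ℝ) (β := ℝ))
    rwa [mul_one] at h
  have hmul : ∀ (c : ℝ → ℝ) (D : ℝ) (hD : ∀ t, |c t| ≤ D), 0 ≤ D → ∀ t,
      LipschitzWith (D.toNNReal * K) (fun x : ℝ × ℝ => c t * g x.1) := by
    intro c D hD hD0 t
    refine ((lipschitzWith_smul (c t)).comp hgx).weaken ?_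
    gcongr
    rw [← NNReal.coe_le_coe]
    simpa [hD0] using hD t
  have hvL : ∀ t, LipschitzWith (max (C₁.toNNReal * K + 1) (C₂.toNNReal * K)) (v t) := fun t =>
    ((hmul c₁ C₁ hC₁ hC₁0 t).sub hclx).prodMk (hmul c₂ C₂ hC₂ hC₂0 t)
  have hvB : ∀ t x, ‖v t x‖ ≤ C₁ * B + C := by
    intro t x
    have h1 : |c₁ t * g x.1| ≤ C₁ * B := by
      rw [abs_mul]; exact mul_le_mul (hC₁ t) (hB _) (abs_nonneg _) hC₁0
    have h2 : |c₂ t * g x.1| ≤ C := by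
      rw [abs_mul]; exact mul_le_mul (hC₂ t) (hB _) (abs_nonneg _) hC₂0
    rw [Prod.norm_def]
    refine max_le ?_ ?_
    · exact (norm_sub_le _ _).trans (add_le_add h1 (hclB _))
    · refine (show ‖(v t x).2‖ ≤ C from h2).trans ?_
      have : 0 ≤ C₁ * B := by positivity
      linarith
  -- Solving on `[-1, 2]` makes the derivatives at `0` and `1` two-sided. The radius is the maximal
  -- speed times `2`, the longest time from the start.
  have hPL : IsPicardLindelof v (tmin := -1) (tmax := 2) ⟨0, by norm_num, by norm_num⟩ (w₀, 0)
      (2 * (C₁ * B + C).toNNReal) 0 (C₁ * B + C).toNNReal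
      (max (C₁.toNNReal * K + 1) (C₂.toNNReal * K)) := by
    refine ⟨fun t _ => (hvL t).lipschitzOnWith, fun x _ => ?_, fun t _ x _ => ?_, ?_⟩
    · exact Continuous.continuousOn (by fun_prop)
    · rw [Real.coe_toNNReal _ (by positivity)]; exact hvB t x
    · norm_num
      linarith [show 0 ≤ max (C₁ * B + C) 0 from le_max_right _ _]
  obtain ⟨x, hx0, hx⟩ := hPL.exists_eq_forall_mem_Icc_hasDerivWithinAt₀
  have hx' : ∀ t ∈ Icc (0 : ℝ) 1, HasDerivAt x (v t (x t)) t := fun t ht =>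
    (hx t ⟨by linarith [ht.1], by linarith [ht.2]⟩).hasDerivAt
      (Icc_mem_nhds (by linarith [ht.1]) (by linarith [ht.2]))
  have hG : ∀ t ∈ Icc (0 : ℝ) 1, HasDerivAt (fun t => (x t).2) (c₂ t * g (x t).1) t := fun t ht =>
    (hasFDerivAt_snd (𝕜 := ℝ) (E := ℝ) (F := ℝ) (p := x t)).comp_hasDerivAt t (hx' t ht)
  have hW : ∀ t ∈ Icc (0 : ℝ) 1, HasDerivAt (fun t => (x t).1)
      (c₁ t * g (x t).1 - cl (x t).2) t := fun t ht =>
    (hasFDerivAt_fst (𝕜 := ℝ) (E := ℝ) (F := ℝ) (p := x t)).comp_hasDerivAt t (hx' t ht)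
  have hx0' : x 0 = (w₀, 0) := hx0
  have hGb : ∀ t ∈ Icc (0 : ℝ) 1, |(x t).2| ≤ C := by
    intro t ht
    have := norm_image_sub_le_of_norm_deriv_le_segment' (f := fun t => (x t).2) (C := C)
      (fun s hs => (hG s hs).hasDerivWithinAt) (fun s _ => by
        rw [Real.norm_eq_abs, abs_mul]; exact mul_le_mul (hC₂ s) (hB _) (abs_nonneg _) hC₂0) t ht
    simp only [hx0', sub_zero, Real.norm_eq_abs] at this
    nlinarith [ht.2]
  refine ⟨fun t => (x t).1, fun t => (x t).2, by simp [hx0'], by simp [hx0'], fun s hs => ?_, hG⟩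
  have h := hW s hs
  have h2 := abs_le.1 (hGb s hs)
  rwa [show cl (x s).2 = (x s).2 by simp [hcl, h2.1, h2.2]] at h

/-! ### Shots and the shooting argument -/

/-- A solution on `[0, 1]` of the rescaled profile system, written in the variable `s = 1 - ξ`:
`W` stands for `f ^ m`, `g (W)` for `f`, and `G` for the flux. -/
structure IsShot (a b σ lam w₀ : ℝ) (g W G : ℝ → ℝ) : Prop where
  W_zero : W 0 = w₀
  G_zero : G 0 = 0
  hW : ∀ s ∈ Icc (0 : ℝ) 1, HasDerivAt W (b * (1 - s) * g (W s) - G s) s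
  hG : ∀ s ∈ Icc (0 : ℝ) 1, HasDerivAt G ((lam * (1 - s) ^ σ - a) * g (W s)) s

/-- The truncation of `t` to `[0, 1]`. -/
noncomputable def unitClamp (t : ℝ) : ℝ := max 0 (min t 1)

theorem unitClamp_of_mem {t : ℝ} (ht : t ∈ Icc (0 : ℝ) 1) : unitClamp t = t := by
  simp [unitClamp, ht.1, ht.2]

theorem unitClamp_mem (t : ℝ) : unitClamp t ∈ Icc (0 : ℝ) 1 :=
  ⟨le_max_left _ _, max_le zero_le_one (min_le_right _ _)⟩

theorem continuous_unitClamp : Continuous unitClamp := by unfold unitClamp; fun_prop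

theorem one_sub_rpow_mem {σ t : ℝ} (hσ : 0 < σ) (ht : t ∈ Icc (0 : ℝ) 1) :
    (1 - t) ^ σ ∈ Icc (0 : ℝ) 1 :=
  ⟨Real.rpow_nonneg (by linarith [ht.2]) _,
    Real.rpow_le_one (by linarith [ht.2]) (by linarith [ht.1]) hσ.le⟩

/-- The vector field of the rescaled profile system, with coefficients frozen outside `[0, 1]`. -/
noncomputable def shotField (a b σ lam : ℝ) (g : ℝ → ℝ) (t : ℝ) (x : ℝ × ℝ) : ℝ × ℝ :=
  (b * (1 - unitClamp t) * g x.1 - x.2, (lam * (1 - unitClamp t) ^ σ - a) * g x.1)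

section Shot

variable {a b σ lam w₀ : ℝ} {g W G : ℝ → ℝ} {K : ℝ≥0}

theorem abs_shot_coeff₁_le (hb : 0 ≤ b) (t : ℝ) : |b * (1 - unitClamp t)| ≤ b := by
  have h := unitClamp_mem t
  rw [abs_of_nonneg (mul_nonneg hb (by linarith [h.2]))]
  nlinarith [h.1]

theorem abs_shot_coeff₂_le (hσ : 0 < σ) (t : ℝ) :
    |lam * (1 - unitClamp t) ^ σ - a| ≤ |lam| + |a| := by
  refine (abs_sub _ _).trans ?_
  have h := one_sub_rpow_mem hσ (unitClamp_mem t)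
  rw [abs_mul, abs_of_nonneg h.1]
  nlinarith [h.2, abs_nonneg lam]

theorem exists_lipschitzWith_shotField (hσ : 0 < σ) (hb : 0 ≤ b) (hg : LipschitzWith K g) :
    ∃ K' : ℝ≥0, ∀ t, LipschitzWith K' (shotField a b σ lam g t) := by
  have hgx : LipschitzWith K (fun x : ℝ × ℝ => g x.1) := by
    have h := hg.comp (LipschitzWith.prod_fst (α := ℝ) (β := ℝ))
    rwa [mul_one] at h
  have hmul : ∀ (c D : ℝ), |c| ≤ D →
      LipschitzWith (D.toNNReal * K) (fun x : ℝ × ℝ => c * g x.1) := by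
    intro c D hD
    refine ((lipschitzWith_smul c).comp hgx).weaken ?_
    gcongr
    rw [← NNReal.coe_le_coe]
    simpa [(abs_nonneg c).trans hD] using hD
  exact ⟨_, fun t => ((hmul _ _ (abs_shot_coeff₁_le hb t)).sub LipschitzWith.prod_snd).prodMk
    (hmul _ _ (abs_shot_coeff₂_le (lam := lam) (a := a) hσ t))⟩

theorem exists_isShot (hσ : 0 < σ) (hb : 0 ≤ b) (hg : LipschitzWith K g) {B : ℝ}
    (hB : ∀ w, |g w| ≤ B) (a lam w₀ : ℝ) : ∃ W G, IsShot a b σ lam w₀ g W G := by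
  have hu : ∀ t, 0 ≤ 1 - unitClamp t := fun t => by linarith [(unitClamp_mem t).2]
  have hc := continuous_unitClamp
  obtain ⟨W, G, hW0, hG0, hW, hG⟩ := exists_solution_of_bounded_lipschitz
    (c₁ := fun t => b * (1 - unitClamp t)) (c₂ := fun t => lam * (1 - unitClamp t) ^ σ - a)
    (by fun_prop) (((continuous_const.sub hc).rpow_const fun _ => Or.inr hσ.le).const_mul lam
      |>.sub continuous_const)
    (abs_shot_coeff₁_le hb) (abs_shot_coeff₂_le hσ) hg hB w₀
  refine ⟨W, G, hW0, hG0, fun s hs => ?_, fun s hs => ?_⟩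
  · simpa only [unitClamp_of_mem hs] using hW s hs
  · simpa only [unitClamp_of_mem hs] using hG s hs

namespace IsShot

theorem continuousOn_W (h : IsShot a b σ lam w₀ g W G) : ContinuousOn W (Icc 0 1) :=
  fun s hs => (h.hW s hs).continuousAt.continuousWithinAt

theorem continuousOn_G (h : IsShot a b σ lam w₀ g W G) : ContinuousOn G (Icc 0 1) :=
  fun s hs => (h.hG s hs).continuousAt.continuousWithinAt

theorem hasDerivAt_prod (h : IsShot a b σ lam w₀ g W G) {s : ℝ} (hs : s ∈ Icc (0 : ℝ) 1) :
    HasDerivAt (fun s => (W s, G s)) (shotField a b σ lam g s (W s, G s)) s := by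
  have := (h.hW s hs).prodMk (h.hG s hs)
  simpa only [shotField, unitClamp_of_mem hs] using this

/-- Once `W ≤ 0` and `G ≥ 0`, the flux is frozen and `W` continues affinely. -/
theorem eq_of_nonpos (h : IsShot a b σ lam w₀ g W G) (hσ : 0 < σ) (hb : 0 ≤ b)
    (hg : LipschitzWith K g) (hg0 : ∀ w ≤ 0, g w = 0) {s₁ : ℝ} (hs₁ : s₁ ∈ Icc (0 : ℝ) 1)
    (hW₁ : W s₁ ≤ 0) (hG₁ : 0 ≤ G s₁) {s : ℝ} (hs : s ∈ Icc s₁ 1) :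
    W s = W s₁ - G s₁ * (s - s₁) ∧ G s = G s₁ := by
  obtain ⟨K', hK'⟩ := exists_lipschitzWith_shotField (a := a) (lam := lam) hσ hb hg
  have hmem : ∀ t ∈ Icc s₁ 1, t ∈ Icc (0 : ℝ) 1 := fun t ht => ⟨hs₁.1.trans ht.1, ht.2⟩
  -- The affine continuation stays nonpositive, where `g` vanishes, so it solves the system and
  -- uniqueness identifies it with the shot.
  have hd : ∀ t ∈ Icc s₁ 1, HasDerivAt (fun t => (W s₁ - G s₁ * (t - s₁), G s₁))
      (shotField a b σ lam g t (W s₁ - G s₁ * (t - s₁), G s₁)) t := by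
    intro t ht
    have h0 : g (W s₁ - G s₁ * (t - s₁)) = 0 :=
      hg0 _ (by nlinarith [mul_nonneg hG₁ (sub_nonneg.2 ht.1)])
    simp only [shotField, h0, mul_zero, zero_sub]
    refine HasDerivAt.prodMk ?_ (hasDerivAt_const t _)
    simpa using (((hasDerivAt_id t).sub_const s₁).const_mul (G s₁)).const_sub (W s₁)
  have := ODE_solution_unique hK' (f := fun s => (W s, G s))
    (g := fun t => (W s₁ - G s₁ * (t - s₁), G s₁)) (a := s₁) (b := 1)
    (fun t ht => (h.hasDerivAt_prod (hmem t ht)).continuousAt.continuousWithinAt)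
    (fun t ht => (h.hasDerivAt_prod (hmem t (Ico_subset_Icc_self ht))).hasDerivWithinAt)
    (fun t ht => (hd t ht).continuousAt.continuousWithinAt)
    (fun t ht => (hd t (Ico_subset_Icc_self ht)).hasDerivWithinAt) (by simp) hs
  simpa using this

/-- Quantitative dependence of the final flux on the parameter `lam`. -/
theorem exists_dist_le (hσ : 0 < σ) (hb : 0 ≤ b) (hg : LipschitzWith K g) {B : ℝ}
    (hB : ∀ w, |g w| ≤ B) (a lam w₀ : ℝ) : ∃ K' : ℝ, ∀ lam' W G W' G',
      IsShot a b σ lam w₀ g W G → IsShot a b σ lam' w₀ g W' G' →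
      dist (G' 1) (G 1) ≤ gronwallBound 0 K' (|lam' - lam| * B) 1 := by
  obtain ⟨K', hK'⟩ := exists_lipschitzWith_shotField (a := a) (lam := lam) hσ hb hg
  refine ⟨K', fun lam' W G W' G' h h' => ?_⟩
  -- The shot for `lam'` is an approximate trajectory of the field for `lam`, with error at most
  -- `|lam' - lam| * B`. The Lipschitz constant is thus independent of `lam'`.
  have := dist_le_of_approx_trajectories_ODE hK' (f := fun s => (W' s, G' s))
    (g := fun s => (W s, G s)) (a := 0) (b := 1) (εf := |lam' - lam| * B) (εg := 0) (δ := 0)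
    (fun t ht => (h'.hasDerivAt_prod ht).continuousAt.continuousWithinAt)
    (fun t ht => (h'.hasDerivAt_prod (Ico_subset_Icc_self ht)).hasDerivWithinAt)
    (fun t ht => by
      have hu := one_sub_rpow_mem hσ (unitClamp_mem t)
      have h1 : (lam' * (1 - unitClamp t) ^ σ - a) * g (W' t) -
          (lam * (1 - unitClamp t) ^ σ - a) * g (W' t) =
          (lam' - lam) * ((1 - unitClamp t) ^ σ * g (W' t)) := by ring
      have hB0 : 0 ≤ B := (abs_nonneg _).trans (hB 0)
      simp only [shotField, Prod.dist_eq, dist_self, Real.dist_eq, h1]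
      refine max_le (by positivity) ?_
      rw [abs_mul, abs_mul, abs_of_nonneg hu.1]
      gcongr
      exact (mul_le_of_le_one_left (abs_nonneg _) hu.2).trans (hB _))
    (fun t ht => (h.hasDerivAt_prod ht).continuousAt.continuousWithinAt)
    (fun t ht => (h.hasDerivAt_prod (Ico_subset_Icc_self ht)).hasDerivWithinAt)
    (fun t ht => by simp) (by simp [h.W_zero, h'.W_zero, h.G_zero, h'.G_zero]) 1 (by simp)
  simp only [Prod.dist_eq, add_zero, sub_zero] at this
  exact (le_max_right _ _).trans this

/-- The shooting argument: a parameter with zero final flux exists between two parameters whose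
final fluxes have opposite signs. -/
theorem exists_final_flux_eq_zero (hσ : 0 < σ) (hb : 0 ≤ b) (hg : LipschitzWith K g) {B : ℝ}
    (hB : ∀ w, |g w| ≤ B) {lam₀ lam₁ : ℝ} (hlam : lam₀ ≤ lam₁)
    (h₀ : ∀ W G, IsShot a b σ lam₀ w₀ g W G → G 1 ≤ 0)
    (h₁ : ∀ W G, IsShot a b σ lam₁ w₀ g W G → 0 ≤ G 1) :
    ∃ lam ∈ Icc lam₀ lam₁, ∃ W G, IsShot a b σ lam w₀ g W G ∧ G 1 = 0 := by
  choose W G h using fun lam => exists_isShot hσ hb hg hB a lam w₀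
  have hcont : Continuous fun lam => G lam 1 := by
    rw [continuous_iff_continuousAt]
    intro lam
    obtain ⟨K', hK'⟩ := exists_dist_le hσ hb hg hB a lam w₀
    rw [ContinuousAt, tendsto_iff_dist_tendsto_zero]
    refine squeeze_zero (fun _ => dist_nonneg) (fun lam' => hK' lam' _ _ _ _ (h lam) (h lam')) ?_
    have h1 : Continuous fun lam' => gronwallBound 0 K' (|lam' - lam| * B) 1 :=
      (gronwallBound_continuous_ε 0 K' 1).comp (by fun_prop)
    simpa [gronwallBound_ε0_δ0] using h1.tendsto lam
  obtain ⟨lam, hl, hl0⟩ := intermediate_value_Icc hlam hcont.continuousOn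
    (show (0 : ℝ) ∈ Icc _ _ from ⟨h₀ _ _ (h lam₀), h₁ _ _ (h lam₁)⟩)
  exact ⟨lam, hl, W lam, G lam, h lam, hl0⟩

/-- If the final flux vanishes then the flux is nonnegative throughout. -/
theorem G_nonneg (h : IsShot a b σ lam w₀ g W G) (hσ : 0 < σ) (hlam : 0 ≤ lam)
    (hg : ∀ w, 0 ≤ g w) (hG1 : G 1 = 0) {s : ℝ} (hs : s ∈ Icc (0 : ℝ) 1) : 0 ≤ G s := by
  by_contra! hneg
  have hs0 : 0 < s := hs.1.lt_of_ne (by rintro rfl; simp [h.G_zero] at hneg)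
  have hs1 : s < 1 := hs.2.lt_of_ne (by rintro rfl; simp [hG1] at hneg)
  -- A negative value between two zeros forces `G' < 0` at an earlier time and `G' > 0` at a later
  -- one, but `lam (1 - s) ^ σ - a` is nonincreasing in `s`.
  obtain ⟨t, ht, hte⟩ := exists_hasDerivAt_eq_slope G _ hs0
    (h.continuousOn_G.mono (Icc_subset_Icc_right hs.2))
    fun t ht => h.hG t ⟨ht.1.le, ht.2.le.trans hs.2⟩
  obtain ⟨t', ht', hte'⟩ := exists_hasDerivAt_eq_slope G _ hs1
    (h.continuousOn_G.mono (Icc_subset_Icc_left hs.1))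
    fun t ht => h.hG t ⟨hs.1.trans ht.1.le, ht.2.le⟩
  have h1 : (lam * (1 - t) ^ σ - a) * g (W t) < 0 := by
    rw [hte, h.G_zero]; exact div_neg_of_neg_of_pos (by linarith) (by linarith)
  have h2 : 0 < (lam * (1 - t') ^ σ - a) * g (W t') := by
    rw [hte', hG1]; exact div_pos (by linarith) (by linarith)
  have h3 : lam * (1 - t) ^ σ - a < 0 := by
    by_contra! hc; exact absurd (mul_nonneg hc (hg (W t))) (not_le.2 h1)
  have h4 : 0 < lam * (1 - t') ^ σ - a := pos_of_mul_pos_left h2 (hg _)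
  have h5 : (1 - t') ^ σ ≤ (1 - t) ^ σ :=
    Real.rpow_le_rpow (by linarith [ht'.2]) (by linarith [ht.2, ht'.1]) hσ.le
  nlinarith [mul_le_mul_of_nonneg_left h5 hlam]

/-- If the final flux vanishes then `W` is nonnegative throughout. -/
theorem W_nonneg (h : IsShot a b σ lam w₀ g W G) (hσ : 0 < σ) (hb : 0 ≤ b) (hlam : 0 ≤ lam)
    (hgL : LipschitzWith K g) (hg0 : ∀ w ≤ 0, g w = 0)
    (hg : ∀ w, 0 ≤ g w) (hw₀ : 0 ≤ w₀) (hG1 : G 1 = 0) {s : ℝ} (hs : s ∈ Icc (0 : ℝ) 1) :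
    0 ≤ W s := by
  by_contra! hneg
  obtain ⟨s₁, hs₁, hW₁⟩ := intermediate_value_Icc' hs.1
    (h.continuousOn_W.mono (Icc_subset_Icc_right hs.2))
    (show (0 : ℝ) ∈ Icc _ _ from ⟨hneg.le, h.W_zero ▸ hw₀⟩)
  have hs₁' : s₁ ∈ Icc (0 : ℝ) 1 := ⟨hs₁.1, hs₁.2.trans hs.2⟩
  have hG := h.G_nonneg hσ hlam hg hG1 hs₁'
  -- The flux is frozen after the zero `s₁` of `W` and ends at zero, so it is zero from `s₁` on and
  -- `W` cannot leave `0`.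
  have e1 := (h.eq_of_nonpos hσ hb hgL hg0 hs₁' hW₁.le hG (right_mem_Icc.2 hs₁'.2)).2
  have e2 := (h.eq_of_nonpos hσ hb hgL hg0 hs₁' hW₁.le hG ⟨hs₁.2, hs.2⟩).1
  rw [← e1, hG1, hW₁] at e2
  linarith

end IsShot
end Shot

/-! ### A priori estimates for shots -/

theorem mul_sub_le_of_le_hasDerivAt {f f' : ℝ → ℝ} {C x y : ℝ} (hxy : x ≤ y)
    (hf : ∀ t ∈ Icc x y, HasDerivAt f (f' t) t) (h : ∀ t ∈ Ioo x y, C ≤ f' t) :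
    C * (y - x) ≤ f y - f x := by
  refine (convex_Icc x y).mul_sub_le_image_sub_of_le_deriv
    (fun t ht => (hf t ht).continuousAt.continuousWithinAt) ?_ ?_ x (left_mem_Icc.2 hxy) y
    (right_mem_Icc.2 hxy) hxy
  · rw [interior_Icc]
    exact fun t ht =>
      (hf t (Ioo_subset_Icc_self ht)).differentiableAt.differentiableWithinAt
  · rw [interior_Icc]
    intro t ht
    rw [(hf t (Ioo_subset_Icc_self ht)).deriv]
    exact h t ht

theorem sub_le_mul_of_hasDerivAt_le {f f' : ℝ → ℝ} {C x y : ℝ} (hxy : x ≤ y)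
    (hf : ∀ t ∈ Icc x y, HasDerivAt f (f' t) t) (h : ∀ t ∈ Ioo x y, f' t ≤ C) :
    f y - f x ≤ C * (y - x) := by
  have := mul_sub_le_of_le_hasDerivAt (f := fun t => - f t) (f' := fun t => - f' t) (C := -C) hxy
    (fun t ht => (hf t ht).neg) fun t ht => neg_le_neg (h t ht)
  linarith

namespace IsShot

variable {a b σ lam θ δ N : ℝ} {W G : ℝ → ℝ}

/-- Upper bound for `W` as long as the flux is nonnegative. -/
theorem le_barrier (h : IsShot a b σ lam δ (regPow θ δ N) W G) (hb : 0 < b) (hθ : 0 < θ)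
    (hθ1 : θ < 1) (hδ : 0 < δ) (hδN : δ ≤ N) {s₁ : ℝ} (hs₁ : s₁ ≤ 1)
    (hG : ∀ s ∈ Icc 0 s₁, 0 ≤ G s) {s : ℝ} (hs : s ∈ Icc 0 s₁) :
    W s ≤ (δ ^ (1 - θ) + b * s) ^ (1 / (1 - θ)) := by
  have hθ' : 0 < 1 - θ := by linarith
  have hpos : ∀ t ∈ Icc 0 s₁, 0 < δ ^ (1 - θ) + b * t := fun t ht =>
    add_pos_of_pos_of_nonneg (Real.rpow_pos_of_pos hδ _) (mul_nonneg hb.le ht.1)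
  have hmem : ∀ t ∈ Icc 0 s₁, t ∈ Icc (0 : ℝ) 1 := fun t ht => ⟨ht.1, ht.2.trans hs₁⟩
  -- The barrier solves `y' = b / (1 - θ) * y ^ θ`, whereas `W' ≤ b * W ^ θ` while `G ≥ 0`. The
  -- factor `1 / (1 - θ) > 1` supplies the strict inequality at contact.
  have hB : ∀ t ∈ Icc 0 s₁, HasDerivAt (fun t => (δ ^ (1 - θ) + b * t) ^ (1 / (1 - θ)))
      (b * (1 / (1 - θ)) * (δ ^ (1 - θ) + b * t) ^ (1 / (1 - θ) - 1)) t := by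
    intro t ht
    have h1 : HasDerivAt (fun t => δ ^ (1 - θ) + b * t) b t := by
      simpa using ((hasDerivAt_id t).const_mul b).const_add (δ ^ (1 - θ))
    exact h1.rpow_const (Or.inl (hpos t ht).ne')
  refine image_le_of_deriv_right_lt_deriv_boundary'
    (h.continuousOn_W.mono (Icc_subset_Icc_right hs₁))
    (fun t ht => (h.hW t (hmem t (Ico_subset_Icc_self ht))).hasDerivWithinAt) ?_
    (fun t ht => (hB t ht).continuousAt.continuousWithinAt)
    (fun t ht => (hB t (Ico_subset_Icc_self ht)).hasDerivWithinAt) (fun t ht he => ?_) hs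
  · rw [h.W_zero, mul_zero, add_zero, ← Real.rpow_mul hδ.le, mul_one_div_cancel hθ'.ne',
      Real.rpow_one]
  · have ht' := Ico_subset_Icc_self ht
    have hp := hpos t ht'
    have hW0 : 0 < W t := by rw [he]; exact Real.rpow_pos_of_pos hp _
    have h1 : regPow θ δ N (W t) ≤ (δ ^ (1 - θ) + b * t) ^ (1 / (1 - θ) - 1) := by
      refine (regPow_le_rpow hθ hθ1 hδ hδN hW0.le).trans_eq ?_
      rw [he, ← Real.rpow_mul hp.le]
      congr 1
      field_simp
      ring
    have h2 := regPow_nonneg hθ hδ hδN (W t)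
    have h3 := hG t ht'
    have h4 : 0 < (δ ^ (1 - θ) + b * t) ^ (1 / (1 - θ) - 1) := Real.rpow_pos_of_pos hp _
    have h5 : 1 < 1 / (1 - θ) := by rw [lt_div_iff₀ hθ']; linarith
    have h6 : b * (1 - t) * regPow θ δ N (W t) ≤ b * regPow θ δ N (W t) := by
      gcongr
      nlinarith [ht'.1]
    nlinarith [mul_le_mul_of_nonneg_left h1 hb.le, mul_pos hb h4,
      mul_lt_mul_of_pos_left h5 (mul_pos hb h4)]

/-- The flux stays small compared to `f` close to the interface. -/
theorem G_lt (h : IsShot a b σ lam δ (regPow θ δ N) W G) (hb : 0 < b) (hθ : 0 < θ)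
    (hδ : 0 < δ) (hδN : δ ≤ N) (ha : 0 ≤ a) (hσ : 0 < σ) (hlam : 0 ≤ lam)
    {Λ : ℝ} (hΛ : lam ≤ Λ) {s₁ : ℝ} (hs₁ : s₁ ≤ 1 / 2) (hs₁Λ : 8 * Λ * s₁ ≤ b)
    {s : ℝ} (hs : s ∈ Icc 0 s₁) : G s < b / 4 * regPow θ δ N (W s) := by
  obtain ⟨K, hK⟩ := exists_lipschitzWith_regPow (θ := θ) hδ hδN
  have hsub : Icc 0 s₁ ⊆ Icc (0 : ℝ) 1 := Icc_subset_Icc_right (by linarith)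
  have hg0 := regPow_nonneg hθ hδ hδN
  by_contra! hc
  have hcont : ContinuousOn (fun s => b / 4 * regPow θ δ N (W s)) (Icc 0 s₁) :=
    continuousOn_const.mul (hK.continuous.comp_continuousOn (h.continuousOn_W.mono hsub))
  have hcomp : IsCompact {s ∈ Icc 0 s₁ | b / 4 * regPow θ δ N (W s) ≤ G s} :=
    isCompact_Icc.of_isClosed_subset
      (isClosed_Icc.isClosed_le hcont (h.continuousOn_G.mono hsub)) (sep_subset _ _)
  -- At the first failure time `t`, `W` has been nondecreasing, since `W' ≥ (b/2 - b/4) f` before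
  -- it. Hence `f` was at most its value at `t`, and integrating `G'` gives `G t ≤ Λ t f ≤ (b/8) f`,
  -- a contradiction.
  obtain ⟨t, ⟨ht, hGt⟩, hmin⟩ := hcomp.exists_isLeast ⟨s, hs, hc⟩
  have hlt : ∀ u ∈ Icc 0 s₁, u < t → G u < b / 4 * regPow θ δ N (W u) := by
    intro u hu hut
    by_contra! h'
    exact absurd (hmin ⟨hu, h'⟩) (not_le.2 hut)
  have hmono : ∀ x ∈ Icc 0 t, ∀ y ∈ Icc x t, W x ≤ W y := by
    intro x hx y hy
    have := mul_sub_le_of_le_hasDerivAt (C := 0) hy.1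
      (fun u hu => h.hW u (hsub ⟨hx.1.trans hu.1, hu.2.trans (hy.2.trans ht.2)⟩))
      (fun u hu => by
        have hu1 : u ∈ Icc 0 s₁ := ⟨hx.1.trans hu.1.le, hu.2.le.trans (hy.2.trans ht.2)⟩
        have h1 := hlt u hu1 (hu.2.trans_le hy.2)
        have h2 : b / 2 * regPow θ δ N (W u) ≤ b * (1 - u) * regPow θ δ N (W u) := by
          refine mul_le_mul_of_nonneg_right ?_ (hg0 _)
          nlinarith [hu1.2]
        nlinarith [hg0 (W u)])
    linarith
  have hf1 : 0 < regPow θ δ N (W t) := by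
    refine lt_of_lt_of_le ?_ (regPow_monotone hθ hδ hδN (hmono 0 ⟨le_rfl, ht.1⟩ t ⟨ht.1, le_rfl⟩))
    rw [h.W_zero, regPow_of_ge hδ le_rfl hδN]
    exact Real.rpow_pos_of_pos hδ _
  have hG' := sub_le_mul_of_hasDerivAt_le (C := Λ * regPow θ δ N (W t)) ht.1
    (fun u hu => h.hG u (hsub ⟨hu.1, hu.2.trans ht.2⟩))
    (fun u hu => by
      have hu1 : u ∈ Icc (0 : ℝ) 1 := hsub ⟨hu.1.le, hu.2.le.trans ht.2⟩
      have h1 := one_sub_rpow_mem hσ hu1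
      refine mul_le_mul ?_ (regPow_monotone hθ hδ hδN (hmono u ⟨hu.1.le, hu.2.le⟩ t
        ⟨hu.2.le, le_rfl⟩)) (hg0 _) (hlam.trans hΛ)
      nlinarith [mul_le_of_le_one_right hlam h1.2])
  rw [h.G_zero, sub_zero, sub_zero] at hG'
  have h8 : Λ * t ≤ b / 8 := by nlinarith [mul_le_mul_of_nonneg_left ht.2 (hlam.trans hΛ)]
  nlinarith [mul_le_mul_of_nonneg_right h8 hf1.le, mul_pos hb hf1]

/-- Nondegeneracy of `W` close to the interface. -/
theorem le_of_small (h : IsShot a b σ lam δ (regPow θ δ N) W G) (hb : 0 < b) (hθ : 0 < θ)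
    (hθ1 : θ < 1) (hδ : 0 < δ) (hδN : δ ≤ N) (ha : 0 ≤ a) (hσ : 0 < σ) (hlam : 0 ≤ lam)
    {Λ : ℝ} (hΛ : lam ≤ Λ) {s₁ : ℝ} (hs₁ : s₁ ≤ 1 / 2) (hs₁Λ : 8 * Λ * s₁ ≤ b)
    (hWN : ∀ s ∈ Icc 0 s₁, W s ≤ N) {s : ℝ} (hs : s ∈ Icc 0 s₁) :
    δ ≤ W s ∧ (1 - θ) * (b / 4) * s ≤ W s ^ (1 - θ) := by
  have hsub : Icc 0 s₁ ⊆ Icc (0 : ℝ) 1 := Icc_subset_Icc_right (by linarith)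
  have hg0 := regPow_nonneg hθ hδ hδN
  have hder : ∀ t ∈ Icc 0 s₁, b / 4 * regPow θ δ N (W t) ≤
      b * (1 - t) * regPow θ δ N (W t) - G t := by
    intro t ht
    have h1 := h.G_lt hb hθ hδ hδN ha hσ hlam hΛ hs₁ hs₁Λ ht
    have h2 : b / 2 * regPow θ δ N (W t) ≤ b * (1 - t) * regPow θ δ N (W t) := by
      refine mul_le_mul_of_nonneg_right ?_ (hg0 _)
      nlinarith [ht.2]
    nlinarith [hg0 (W t)]
  have hδW : ∀ t ∈ Icc 0 s₁, δ ≤ W t := by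
    intro t ht
    have := mul_sub_le_of_le_hasDerivAt (C := 0) ht.1
      (fun u hu => h.hW u (hsub ⟨hu.1, hu.2.trans ht.2⟩)) (fun u hu =>
        (mul_nonneg (by positivity) (hg0 _)).trans (hder u ⟨hu.1.le, hu.2.le.trans ht.2⟩))
    rw [h.W_zero] at this
    linarith
  refine ⟨hδW s hs, ?_⟩
  -- `W' ≥ (b/4) W ^ θ` becomes linear growth for `W ^ (1 - θ)`.
  have := mul_sub_le_of_le_hasDerivAt (f := fun t => W t ^ (1 - θ)) (C := (1 - θ) * (b / 4)) hs.1
    (fun u hu => (h.hW u (hsub ⟨hu.1, hu.2.trans hs.2⟩)).rpow_const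
      (Or.inl (hδ.trans_le (hδW u ⟨hu.1, hu.2.trans hs.2⟩)).ne')) (fun u hu => by
      have hu' : u ∈ Icc 0 s₁ := ⟨hu.1.le, hu.2.le.trans hs.2⟩
      have h1 := hder u hu'
      have hW0 := hδ.trans_le (hδW u hu')
      rw [regPow_of_ge hδ (hδW u hu') (hWN u hu')] at h1 ⊢
      have h2 : (0 : ℝ) ≤ (1 - θ) * W u ^ (1 - θ - 1) :=
        mul_nonneg (by linarith) (Real.rpow_nonneg hW0.le _)
      have h3 := mul_le_mul_of_nonneg_right h1 h2
      have h4 : W u ^ θ * W u ^ (1 - θ - 1) = 1 := by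
        rw [← Real.rpow_add hW0]; simp
      calc (1 - θ) * (b / 4) = b / 4 * W u ^ θ * ((1 - θ) * W u ^ (1 - θ - 1)) := by
            linear_combination (-(1 - θ) * (b / 4)) * h4
        _ ≤ _ := by rw [mul_assoc _ (1 - θ)]; exact h3)
  have h0 : 0 ≤ W 0 ^ (1 - θ) := by rw [h.W_zero]; exact Real.rpow_nonneg hδ.le _
  rw [sub_zero] at this
  linarith

/-- For a large parameter the final flux is nonnegative. -/
theorem final_flux_nonneg (h : IsShot a b σ lam δ (regPow θ δ N) W G) (hb : 0 < b) (hθ : 0 < θ)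
    (hθ1 : θ < 1) (hδ : 0 < δ) (hδN : δ ≤ N) (ha : 0 ≤ a) (hσ : 0 < σ)
    (hδb : δ ^ (1 - θ) ≤ b / 16) (hN : b ≤ N ^ (1 - θ)) (hlam : 4 * b ≤ lam)
    (hlam' : 0 < lam * (1 / 2) ^ σ - a)
    (hnum : 2 * b * N ^ θ ≤ b / (16 * lam) * (lam * (1 / 2) ^ σ - a) *
      ((1 - θ) * (b / 4) * (b / (16 * lam))) ^ (θ / (1 - θ)) *
      Real.exp ((lam * (1 / 2) ^ σ - a) / (2 * b) * (1 / 32))) : 0 ≤ G 1 := by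
  set L := lam * (1 / 2) ^ σ - a with hL
  have hlam0 : 0 < lam := by linarith
  have hN0 : 0 < N := hδ.trans_le hδN
  have hθ' : 0 < 1 - θ := by linarith
  have hg0 := regPow_nonneg hθ hδ hδN
  obtain ⟨K, hK⟩ := exists_lipschitzWith_regPow (θ := θ) hδ hδN
  have hcoef : ∀ t ∈ Icc (0 : ℝ) (1 / 2), L ≤ lam * (1 - t) ^ σ - a := by
    intro t ht
    have : ((1 : ℝ) / 2) ^ σ ≤ (1 - t) ^ σ :=
      Real.rpow_le_rpow (by norm_num) (by linarith [ht.2]) hσ.le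
    have := mul_le_mul_of_nonneg_left this hlam0.le
    linarith
  have hmem : ∀ t ∈ Icc (0 : ℝ) (1 / 2), t ∈ Icc (0 : ℝ) 1 := fun t ht =>
    ⟨ht.1, by linarith [ht.2]⟩
  have hGd : ∀ t ∈ Icc (0 : ℝ) (1 / 2), L * regPow θ δ N (W t) ≤
      (lam * (1 - t) ^ σ - a) * regPow θ δ N (W t) := fun t ht =>
    mul_le_mul_of_nonneg_right (hcoef t ht) (hg0 _)
  have hGmono : ∀ x ∈ Icc (0 : ℝ) (1 / 2), ∀ y ∈ Icc x (1 / 2), G x ≤ G y := by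
    intro x hx y hy
    have := mul_sub_le_of_le_hasDerivAt (C := 0) hy.1
      (fun t ht => h.hG t (hmem t ⟨hx.1.trans ht.1, ht.2.trans hy.2⟩))
      (fun t ht => (mul_nonneg hlam'.le (hg0 _)).trans
        (hGd t ⟨hx.1.trans ht.1.le, ht.2.le.trans hy.2⟩))
    linarith
  have hG0 : ∀ t ∈ Icc (0 : ℝ) (1 / 2), 0 ≤ G t := fun t ht => by
    have := hGmono 0 ⟨le_rfl, by norm_num⟩ t ht
    rwa [h.G_zero] at this
  -- If `W` reaches zero by `1/2`, the flux is frozen at a nonnegative value. The rest shows that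
  -- `W` cannot stay positive that long.
  by_cases hz : ∃ s₁ ∈ Icc (0 : ℝ) (1 / 2), W s₁ ≤ 0
  · obtain ⟨s₁, hs₁, hW₁⟩ := hz
    rw [(h.eq_of_nonpos hσ hb.le hK (fun w hw => regPow_of_nonpos hδ hδN hw) (hmem s₁ hs₁) hW₁
      (hG0 s₁ hs₁) (right_mem_Icc.2 (hmem s₁ hs₁).2)).2]
    exact hG0 s₁ hs₁
  push Not at hz
  exfalso
  have hup : ∀ t ∈ Icc (0 : ℝ) (1 / 2), W t ^ (1 - θ) ≤ δ ^ (1 - θ) + b * t := by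
    intro t ht
    have h1 := h.le_barrier hb hθ hθ1 hδ hδN (s₁ := 1 / 2) (by norm_num) hG0 ht
    have h2 : 0 ≤ δ ^ (1 - θ) + b * t :=
      add_nonneg (Real.rpow_nonneg hδ.le _) (mul_nonneg hb.le ht.1)
    have h3 := Real.rpow_le_rpow (hz t ht).le h1 hθ'.le
    rwa [← Real.rpow_mul h2, one_div_mul_cancel hθ'.ne', Real.rpow_one] at h3
  have hWN : ∀ t ∈ Icc (0 : ℝ) (1 / 2), W t ≤ N := by
    intro t ht
    rw [← Real.rpow_le_rpow_iff (hz t ht).le hN0.le hθ']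
    nlinarith [hup t ht, ht.2]
  by_cases hbig : ∃ s₂ ∈ Icc (0 : ℝ) (1 / 16), 2 * b * regPow θ δ N (W s₂) ≤ G s₂
  · obtain ⟨s₂, hs₂, hGs⟩ := hbig
    have hs₂' : s₂ ∈ Icc (0 : ℝ) (1 / 2) := ⟨hs₂.1, by linarith [hs₂.2]⟩
    have hle := le_mul_regPow hθ1 hδ hδN (hz s₂ hs₂').le (hWN s₂ hs₂')
    -- As `δ ^ (1 - θ) ≤ b/16` and `s₂ ≤ 1/16`, this gives `W s₂ ≤ (b/8) f ≤ G s₂ / 16`. Afterwards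
    -- `W' ≤ -G s₂ / 2`, so even the slope `-G s₂ / 4` makes `W` negative within the remaining
    -- length, at least `7/16`.
    have hmax : max (W s₂ ^ (1 - θ)) (δ ^ (1 - θ)) ≤ b / 8 :=
      max_le (by nlinarith [hup s₂ hs₂', hs₂.2]) (by linarith)
    have h1 := mul_le_mul_of_nonneg_right hmax (hg0 (W s₂))
    have hGpos : 0 < G s₂ := by
      have := hz s₂ hs₂'
      nlinarith
    have hd : ∀ s : ℝ, HasDerivAt (fun s => W s₂ - G s₂ / 4 * (s - s₂)) (-(G s₂ / 4)) s := by
      intro s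
      simpa using (((hasDerivAt_id s).sub_const s₂).const_mul (G s₂ / 4)).const_sub (W s₂)
    have hsub : ∀ t ∈ Icc s₂ (1 / 2), t ∈ Icc (0 : ℝ) (1 / 2) := fun t ht =>
      ⟨hs₂.1.trans ht.1, ht.2⟩
    have := image_le_of_deriv_right_lt_deriv_boundary
      (h.continuousOn_W.mono fun t ht => hmem t (hsub t ht))
      (fun t ht => (h.hW t (hmem t (hsub t (Ico_subset_Icc_self ht)))).hasDerivWithinAt)
      (by simp) hd (fun t ht he => by
        have ht' := Ico_subset_Icc_self ht
        have e1 : W t ≤ W s₂ := by nlinarith [mul_nonneg hGpos.le (sub_nonneg.2 ht.1)]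
        have e2 := regPow_monotone hθ hδ hδN e1
        have e3 := hGmono s₂ hs₂' t ht'
        have e4 : b * (1 - t) * regPow θ δ N (W t) ≤ b * regPow θ δ N (W t) :=
          mul_le_mul_of_nonneg_right (by nlinarith [(hsub t ht').1]) (hg0 _)
        nlinarith [mul_le_mul_of_nonneg_left e2 hb.le])
      (right_mem_Icc.2 hs₂'.2)
    have hz' := hz (1 / 2) ⟨by norm_num, le_rfl⟩
    nlinarith [hs₂.2]
  · push Not at hbig
    -- The longest time allowed by the near-interface estimates with `Λ = lam`. On its second half
    -- `f ≥ f₀`, which makes `G sc` positive by an explicit amount.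
    set sc := b / (8 * lam) with hsc
    have hsc0 : 0 < sc := by positivity
    have hsc1 : sc ≤ 1 / 32 := by
      rw [hsc, div_le_iff₀ (by positivity)]; linarith
    have hsc2 : b / (16 * lam) = sc / 2 := by rw [hsc]; field_simp; norm_num
    rw [hsc2] at hnum
    set f₀ := ((1 - θ) * (b / 4) * (sc / 2)) ^ (θ / (1 - θ)) with hf₀
    have hf₀0 : 0 ≤ f₀ := Real.rpow_nonneg (by positivity) _
    have hlow : ∀ t ∈ Icc (sc / 2) sc, f₀ ≤ regPow θ δ N (W t) := by
      intro t ht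
      have ht' : t ∈ Icc (0 : ℝ) (1 / 2) := ⟨by linarith [ht.1], by linarith [ht.2]⟩
      obtain ⟨e1, e2⟩ := h.le_of_small hb hθ hθ1 hδ hδN ha hσ hlam0.le le_rfl (s₁ := sc)
        (by linarith) (by rw [hsc]; apply le_of_eq; field_simp)
        (fun u hu => hWN u ⟨hu.1, by linarith [hu.2]⟩) (s := t) ⟨ht'.1, ht.2⟩
      rw [regPow_of_ge hδ e1 (hWN t ht')]
      calc f₀ ≤ (W t ^ (1 - θ)) ^ (θ / (1 - θ)) := by
            refine Real.rpow_le_rpow (by positivity) (le_trans ?_ e2) (by positivity)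
            have := ht.1
            gcongr
        _ = W t ^ θ := by
            rw [← Real.rpow_mul (hz t ht').le]
            congr 1
            field_simp
    have hGsc : L * f₀ * (sc / 2) ≤ G sc := by
      have := mul_sub_le_of_le_hasDerivAt (C := L * f₀) (show sc / 2 ≤ sc by linarith)
        (fun t ht => h.hG t ⟨by linarith [ht.1], by linarith [ht.2]⟩)
        (fun t ht => (mul_le_mul_of_nonneg_left (hlow t (Ioo_subset_Icc_self ht)) hlam'.le).trans
          (hGd t ⟨by linarith [ht.1], by linarith [ht.2]⟩))
      have h2 := hG0 (sc / 2) ⟨by linarith, by linarith⟩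
      linarith
    -- Here `G < 2 b f` up to `1/16`, so `G' ≥ L f ≥ L / (2 b) * G` and the flux grows exponentially
    -- for a time at least `1/32`. By `hnum` this exceeds the bound `2 b N ^ θ`.
    have hexp := mul_sub_le_of_le_hasDerivAt
      (f := fun t => G t * Real.exp (-(L / (2 * b)) * t)) (C := 0)
      (show sc ≤ 1 / 16 by linarith)
      (fun t ht => (h.hG t ⟨by linarith [ht.1], by linarith [ht.2]⟩).mul
        (((hasDerivAt_id t).const_mul (-(L / (2 * b)))).exp))
      (fun t ht => by
        have e1 := hGd t ⟨by linarith [ht.1], by linarith [ht.2]⟩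
        have e2 := hbig t ⟨by linarith [ht.1], by linarith [ht.2]⟩
        have e3 : L / (2 * b) * G t ≤ L * regPow θ δ N (W t) := by
          have := mul_le_mul_of_nonneg_left e2.le (show 0 ≤ L / (2 * b) by positivity)
          refine this.trans_eq ?_
          field_simp
        have e4 := Real.exp_pos (-(L / (2 * b)) * t)
        simp only [id, mul_one]
        nlinarith [mul_le_mul_of_nonneg_right (e3.trans e1) e4.le])
    simp only [zero_mul, sub_nonneg] at hexp
    have hfin := hbig (1 / 16) ⟨by norm_num, le_rfl⟩
    have hgN := regPow_le (θ := θ) hθ hδ hδN (W (1 / 16))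
    have h1 : G sc * Real.exp (L / (2 * b) * (1 / 32)) ≤ G (1 / 16) := by
      have h2 : G sc * Real.exp (L / (2 * b) * (1 / 16 - sc)) ≤ G (1 / 16) := by
        have := mul_le_mul_of_nonneg_right hexp (Real.exp_pos (L / (2 * b) * (1 / 16))).le
        rw [mul_assoc, mul_assoc, ← Real.exp_add, ← Real.exp_add] at this
        rwa [show -(L / (2 * b)) * (1 / 16) + L / (2 * b) * (1 / 16) = 0 by ring, Real.exp_zero,
          mul_one, show -(L / (2 * b)) * sc + L / (2 * b) * (1 / 16) =
            L / (2 * b) * (1 / 16 - sc) by ring] at this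
      refine le_trans ?_ h2
      have := hG0 sc ⟨hsc0.le, by linarith⟩
      gcongr
      linarith
    have h3 := mul_le_mul_of_nonneg_right hGsc (Real.exp_pos (L / (2 * b) * (1 / 32))).le
    nlinarith [mul_le_mul_of_nonneg_left hgN hb.le]

end IsShot

/-! ### Choice of parameters and uniform bounds -/

/-- The growth condition of `IsShot.final_flux_nonneg` holds for large parameters. -/
theorem exists_large_parameter (C q d : ℝ) {a b c : ℝ} (hb : 0 < b) (hc : 0 < c) (hd : 0 < d)
    (M : ℝ) : ∃ lam, M ≤ lam ∧ 0 < lam * c - a ∧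
      C ≤ b / (16 * lam) * (lam * c - a) * (d * (b / (16 * lam))) ^ q *
        Real.exp ((lam * c - a) / (2 * b) * (1 / 32)) := by
  have ht := tendsto_exp_mul_div_rpow_atTop q (c / (128 * b)) (by positivity)
  set D := b * c / 32 * (d * b / 16) ^ q with hD
  have hD0 : 0 < D := by positivity
  -- For `lam > 2 a / c` one has `lam c - a ≥ lam c / 2`. The prefactor is then at least a constant
  -- times `lam ^ (-q)`, which the exponential beats.
  obtain ⟨lam, h1, h2, h3, h4⟩ := ((ht.eventually_ge_atTop (C / D)).and
    ((eventually_ge_atTop M).and ((eventually_gt_atTop 0).and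
      (eventually_gt_atTop (2 * a / c))))).exists
  rw [div_lt_iff₀ hc] at h4
  have h5 : lam * c / 2 ≤ lam * c - a := by linarith
  have h6 : 0 < lam * c / 2 := by positivity
  refine ⟨lam, h2, by linarith, ?_⟩
  rw [div_le_iff₀ hD0] at h1
  refine h1.trans ?_
  calc Real.exp (c / (128 * b) * lam) / lam ^ q * D
      = b / (16 * lam) * (lam * c / 2) * (d * (b / (16 * lam))) ^ q *
        Real.exp ((lam * c / 2) / (2 * b) * (1 / 32)) := by
        have e1 : (d * (b / (16 * lam))) ^ q = (d * b / 16) ^ q / lam ^ q := by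
          rw [← Real.div_rpow (by positivity) h3.le]
          congr 1
          field_simp
        have e2 : (lam * c / 2) / (2 * b) * (1 / 32) = c / (128 * b) * lam := by
          field_simp; norm_num
        rw [e1, e2, hD]
        field_simp
        norm_num
    _ ≤ _ := by
        have : 0 ≤ lam * c - a := h6.le.trans h5
        gcongr

/-- Regularized solutions with vanishing final flux, with bounds uniform in the regularization. -/
theorem exists_uniform_isShot {a b σ θ : ℝ} (ha : 0 < a) (hb : 0 < b) (hσ : 0 < σ) (hθ : 0 < θ)
    (hθ1 : θ < 1) : ∃ Λ N s₁ : ℝ, 0 < N ∧ 0 < s₁ ∧ s₁ ≤ 1 ∧ ∀ δ, 0 < δ → δ ^ (1 - θ) ≤ b / 16 →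
      δ ≤ N ∧ ∃ lam ∈ Icc a Λ, ∃ W G, IsShot a b σ lam δ (regPow θ δ N) W G ∧ G 1 = 0 ∧
        (∀ s ∈ Icc (0 : ℝ) 1, 0 ≤ W s ∧ W s ≤ N) ∧
        ∀ s ∈ Icc 0 s₁, (1 - θ) * (b / 4) * s ≤ W s ^ (1 - θ) := by
  have hθ' : 0 < 1 - θ := by linarith
  -- The barrier is at most `(δ ^ (1 - θ) + b) ^ (1 / (1 - θ)) ≤ N`, so the upper truncation is
  -- never active.
  set N : ℝ := (2 * b) ^ (1 / (1 - θ)) with hN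
  have hN0 : 0 < N := by positivity
  have hNpow : N ^ (1 - θ) = 2 * b := by
    rw [hN, ← Real.rpow_mul (by positivity), one_div_mul_cancel hθ'.ne', Real.rpow_one]
  obtain ⟨Λ, hΛ, hΛ', hnum⟩ := exists_large_parameter (2 * b * N ^ θ) (θ / (1 - θ))
    ((1 - θ) * (b / 4)) (a := a) (c := (1 / 2) ^ σ) hb (by positivity) (by positivity)
    (max (4 * b) a)
  have hΛb := (le_max_left _ _).trans hΛ
  have hΛa := (le_max_right _ _).trans hΛ
  have hΛ0 : 0 < Λ := by linarith
  have hsc : b / (8 * Λ) ≤ 1 / 2 := by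
    rw [div_le_iff₀ (by positivity)]; linarith
  refine ⟨Λ, N, b / (8 * Λ), hN0, by positivity, by linarith, fun δ hδ hδb => ?_⟩
  have hδN : δ ≤ N := by
    rw [← Real.rpow_le_rpow_iff hδ.le hN0.le hθ', hNpow]; linarith
  obtain ⟨K, hK⟩ := exists_lipschitzWith_regPow (θ := θ) hδ hδN
  have hg0 := regPow_nonneg hθ hδ hδN
  obtain ⟨lam, hlam, W, G, h, hG1⟩ := IsShot.exists_final_flux_eq_zero (a := a) (w₀ := δ)
    hσ hb.le hK (B := N ^ θ)
    (fun w => by rw [abs_of_nonneg (hg0 w)]; exact regPow_le hθ hδ hδN w) hΛa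
    -- At `lam = a` the coefficient `a (1 - s) ^ σ - a` is nonpositive.
    (fun W G h => by
      have := sub_le_mul_of_hasDerivAt_le (C := 0) zero_le_one h.hG (fun s hs => by
        have := one_sub_rpow_mem hσ (Ioo_subset_Icc_self hs)
        exact mul_nonpos_of_nonpos_of_nonneg (by nlinarith [this.2]) (hg0 _))
      rw [h.G_zero] at this
      linarith)
    (fun W G h => h.final_flux_nonneg hb hθ hθ1 hδ hδN ha.le hσ hδb (by linarith) hΛb hΛ' hnum)
  have hlam0 : 0 ≤ lam := ha.le.trans hlam.1
  have hG0 : ∀ s ∈ Icc (0 : ℝ) 1, 0 ≤ G s := fun s hs => h.G_nonneg hσ hlam0 hg0 hG1 hs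
  have hWN : ∀ s ∈ Icc (0 : ℝ) 1, W s ≤ N := fun s hs => by
    have h1 : 0 ≤ δ ^ (1 - θ) := Real.rpow_nonneg hδ.le _
    refine (h.le_barrier hb hθ hθ1 hδ hδN le_rfl hG0 hs).trans ?_
    refine Real.rpow_le_rpow (add_nonneg h1 (mul_nonneg hb.le hs.1)) ?_ (by positivity)
    nlinarith [hs.2]
  refine ⟨hδN, lam, hlam, W, G, h, hG1, fun s hs => ⟨?_, hWN s hs⟩, fun s hs => ?_⟩
  · exact h.W_nonneg hσ hb.le hlam0 hK (fun w hw => regPow_of_nonpos hδ hδN hw) hg0 hδ.le hG1 hs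
  · exact (h.le_of_small hb hθ hθ1 hδ hδN ha.le hσ hlam0 hlam.2 hsc
      (by apply le_of_eq; field_simp) (fun t ht => hWN t ⟨ht.1, by linarith [ht.2]⟩) hs).2

/-! ### Compactness and removal of the regularization -/

/-- Arzelà–Ascoli for uniformly Lipschitz and bounded curves on `[0, 1]`. -/
theorem exists_subseq_tendsto_of_lipschitzOnWith {u : ℕ → ℝ → ℝ × ℝ} {K : ℝ≥0} {R : ℝ}
    (hL : ∀ n, LipschitzOnWith K (u n) (Icc 0 1))
    (hR : ∀ n, ∀ s ∈ Icc (0 : ℝ) 1, u n s ∈ Metric.closedBall 0 R) :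
    ∃ φ : ℕ → ℕ, StrictMono φ ∧ ∃ v : ℝ → ℝ × ℝ, Continuous v ∧
      ∀ s ∈ Icc (0 : ℝ) 1, Tendsto (fun n => u (φ n) s) atTop (𝓝 (v s)) := by
  let A : Set (BoundedContinuousFunction (Icc (0 : ℝ) 1) (ℝ × ℝ)) :=
    {f | (∀ x y, dist (f x) (f y) ≤ K * dist x y) ∧ ∀ x, f x ∈ Metric.closedBall 0 R}
  have hev : ∀ x : Icc (0 : ℝ) 1,
      Continuous fun f : BoundedContinuousFunction (Icc (0 : ℝ) 1) (ℝ × ℝ) => f x :=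
    fun x => continuous_eval_const x
  have hA : IsCompact A := by
    refine BoundedContinuousFunction.arzela_ascoli₂ _
      (isCompact_closedBall (0 : ℝ × ℝ) R) A ?_ (fun f x hf => hf.2 x) ?_
    · have hAeq : A = (⋂ x, ⋂ y, {f | dist (f x) (f y) ≤ K * dist x y}) ∩
          ⋂ x, (fun f => f x) ⁻¹' Metric.closedBall 0 R := by
        ext f
        simp only [mem_inter_iff, mem_iInter]
        exact Iff.rfl
      rw [hAeq]
      refine IsClosed.inter ?_ (isClosed_iInter fun x =>
        Metric.isClosed_closedBall.preimage (hev x))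
      exact isClosed_iInter fun x => isClosed_iInter fun y =>
        isClosed_le ((hev x).dist (hev y)) continuous_const
    · exact (LipschitzWith.uniformEquicontinuous _ K fun f =>
        LipschitzWith.of_dist_le_mul f.2.1).equicontinuous
  have hc : ∀ n, Continuous ((Icc (0 : ℝ) 1).domRestrict (u n)) := fun n =>
    continuousOn_iff_continuous_domRestrict.1 (hL n).continuousOn
  let F : ℕ → BoundedContinuousFunction (Icc (0 : ℝ) 1) (ℝ × ℝ) := fun n =>
    BoundedContinuousFunction.mkOfCompact ⟨_, hc n⟩
  obtain ⟨f, -, φ, hφ, hf⟩ := hA.isSeqCompact (x := F) fun n =>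
    ⟨fun x y => (hL n).dist_le_mul x x.2 y y.2, fun x => hR n x x.2⟩
  refine ⟨φ, hφ, IccExtend zero_le_one f, f.continuous.Icc_extend', fun s hs => ?_⟩
  rw [IccExtend_of_mem _ _ hs]
  exact ((hev ⟨s, hs⟩).tendsto f).comp hf

/-- Dominated convergence passes the integral equation to the limit, and continuity of `v'` lets it
be differentiated again. Pointwise convergence of the derivatives suffices. -/
theorem hasDerivWithinAt_of_tendsto_of_bounded {u u' : ℕ → ℝ → ℝ} {v v' : ℝ → ℝ} {C : ℝ}
    (hd : ∀ n, ∀ s ∈ Icc (0 : ℝ) 1, HasDerivAt (u n) (u' n s) s)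
    (hc : ∀ n, ContinuousOn (u' n) (Icc 0 1))
    (hb : ∀ n, ∀ s ∈ Icc (0 : ℝ) 1, |u' n s| ≤ C)
    (hlim : ∀ s ∈ Icc (0 : ℝ) 1, Tendsto (fun n => u n s) atTop (𝓝 (v s)))
    (hlim' : ∀ s ∈ Icc (0 : ℝ) 1, Tendsto (fun n => u' n s) atTop (𝓝 (v' s)))
    (hv' : Continuous v') {s : ℝ} (hs : s ∈ Icc (0 : ℝ) 1) :
    HasDerivWithinAt v (v' s) (Icc 0 1) s := by
  have hint : ∀ t ∈ Icc (0 : ℝ) 1, v t = v 0 + ∫ x in (0 : ℝ)..t, v' x := by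
    intro t ht
    have hsub : uIcc 0 t ⊆ Icc (0 : ℝ) 1 := by
      rw [uIcc_of_le ht.1]; exact Icc_subset_Icc_right ht.2
    have h1 : Tendsto (fun n => ∫ x in (0 : ℝ)..t, u' n x) atTop
        (𝓝 (∫ x in (0 : ℝ)..t, v' x)) := by
      refine intervalIntegral.tendsto_integral_filter_of_dominated_convergence (fun _ => C) ?_ ?_
        intervalIntegrable_const ?_
      · exact Eventually.of_forall fun n => ((hc n).mono
          (uIoc_subset_uIcc.trans hsub)).aestronglyMeasurable measurableSet_uIoc
      · exact Eventually.of_forall fun n => Eventually.of_forall fun x hx =>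
          hb n x (hsub (uIoc_subset_uIcc hx))
      · exact Eventually.of_forall fun x hx => hlim' x (hsub (uIoc_subset_uIcc hx))
    have h2 : ∀ n, ∫ x in (0 : ℝ)..t, u' n x = u n t - u n 0 := fun n =>
      intervalIntegral.integral_eq_sub_of_hasDerivAt (fun x hx => hd n x (hsub hx))
        ((hc n).mono hsub).intervalIntegrable
    simp only [h2] at h1
    have := tendsto_nhds_unique h1 ((hlim t ht).sub (hlim 0 ⟨le_rfl, zero_le_one⟩))
    linarith
  have hder : HasDerivAt (fun t => v 0 + ∫ x in (0 : ℝ)..t, v' x) (v' s) s :=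
    (intervalIntegral.integral_hasDerivAt_right (hv'.intervalIntegrable _ _)
      (hv'.stronglyMeasurableAtFilter _ _) hv'.continuousAt).const_add _
  exact hder.hasDerivWithinAt.congr hint (hint s hs)

/-- Existence of a solution of the rescaled degenerate profile system that starts at an interface
and ends with zero flux. -/
theorem exists_degenerate_shot {a b σ θ : ℝ} (ha : 0 < a) (hb : 0 < b) (hσ : 0 < σ) (hθ : 0 < θ)
    (hθ1 : θ < 1) : ∃ lam : ℝ, 0 < lam ∧ ∃ W G : ℝ → ℝ, Continuous W ∧ Continuous G ∧
      W 0 = 0 ∧ G 0 = 0 ∧ G 1 = 0 ∧ (∀ s ∈ Icc (0 : ℝ) 1, 0 ≤ W s) ∧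
      (∃ s₁, 0 < s₁ ∧ s₁ ≤ 1 ∧ ∀ s ∈ Ioc 0 s₁, 0 < W s) ∧
      (∀ s ∈ Icc (0 : ℝ) 1,
        HasDerivWithinAt W (b * (1 - s) * W s ^ θ - G s) (Icc 0 1) s) ∧
      ∀ s ∈ Icc (0 : ℝ) 1,
        HasDerivWithinAt G ((lam * (1 - s) ^ σ - a) * W s ^ θ) (Icc 0 1) s := by
  have hθ' : 0 < 1 - θ := by linarith
  obtain ⟨Λ, N, s₁, hN, hs₁, hs₁1, H⟩ := exists_uniform_isShot ha hb hσ hθ hθ1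
  obtain ⟨δ, hδlim, hδ⟩ : ∃ δ : ℕ → ℝ, Tendsto δ atTop (𝓝 0) ∧
      ∀ n, 0 < δ n ∧ δ n ^ (1 - θ) ≤ b / 16 := by
    have hD : (0 : ℝ) < (b / 16) ^ (1 / (1 - θ)) := by positivity
    obtain ⟨δ, -, hδ, hlim⟩ := exists_seq_strictAnti_tendsto' hD
    refine ⟨δ, hlim, fun n => ⟨(hδ n).1, ?_⟩⟩
    have := Real.rpow_le_rpow (hδ n).1.le (hδ n).2.le hθ'.le
    rwa [← Real.rpow_mul (by positivity), one_div_mul_cancel hθ'.ne', Real.rpow_one] at this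
  choose hδN lam hlam W G h hG1 hWb hlow using fun n => H (δ n) (hδ n).1 (hδ n).2
  set B := N ^ θ with hB
  have hB0 : 0 < B := by positivity
  have hg : ∀ n w, 0 ≤ regPow θ (δ n) N w ∧ regPow θ (δ n) N w ≤ B := fun n w =>
    ⟨regPow_nonneg hθ (hδ n).1 (hδN n) w, regPow_le hθ (hδ n).1 (hδN n) w⟩
  have hΛ : 0 < Λ := ha.trans_le ((hlam 0).1.trans (hlam 0).2)
  set C := (Λ + a) * B with hC
  have hC0 : 0 < C := by positivity
  have hG' : ∀ n, ∀ s ∈ Icc (0 : ℝ) 1,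
      |(lam n * (1 - s) ^ σ - a) * regPow θ (δ n) N (W n s)| ≤ C := by
    intro n s hs
    have h1 := one_sub_rpow_mem hσ hs
    have h2 : 0 ≤ lam n := ha.le.trans (hlam n).1
    have h3 := mul_nonneg h2 h1.1
    rw [abs_mul, abs_of_nonneg (hg n _).1]
    refine mul_le_mul (abs_le.2 ⟨by linarith, ?_⟩) (hg n _).2 (hg n _).1 (by positivity)
    have := mul_le_of_le_one_right h2 h1.2
    linarith [(hlam n).2]
  have hGb : ∀ n, ∀ s ∈ Icc (0 : ℝ) 1, |G n s| ≤ C := by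
    intro n s hs
    have := norm_image_sub_le_of_norm_deriv_le_segment' (f := G n) (C := C)
      (fun t ht => ((h n).hG t ht).hasDerivWithinAt)
      (fun t ht => hG' n t (Ico_subset_Icc_self ht)) s hs
    rw [(h n).G_zero, sub_zero, sub_zero, Real.norm_eq_abs] at this
    nlinarith [hs.2]
  have hW' : ∀ n, ∀ s ∈ Icc (0 : ℝ) 1,
      |b * (1 - s) * regPow θ (δ n) N (W n s) - G n s| ≤ b * B + C := by
    intro n s hs
    refine (abs_sub _ _).trans (add_le_add ?_ (hGb n s hs))
    rw [abs_of_nonneg (mul_nonneg (mul_nonneg hb.le (by linarith [hs.2])) (hg n _).1)]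
    refine mul_le_mul ?_ (hg n _).2 (hg n _).1 hb.le
    nlinarith [hs.1]
  have hlip : ∀ n, LipschitzOnWith (max (b * B + C).toNNReal C.toNNReal)
      (fun s => (W n s, G n s)) (Icc 0 1) := by
    intro n
    refine LipschitzOnWith.prodMk ?_ ?_
    · refine (convex_Icc 0 1).lipschitzOnWith_of_nnnorm_hasDerivWithin_le
        (fun s hs => ((h n).hW s hs).hasDerivWithinAt) fun s hs => ?_
      rw [← NNReal.coe_le_coe, Real.coe_toNNReal _ (by positivity)]
      exact hW' n s hs
    · refine (convex_Icc 0 1).lipschitzOnWith_of_nnnorm_hasDerivWithin_le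
        (fun s hs => ((h n).hG s hs).hasDerivWithinAt) fun s hs => ?_
      rw [← NNReal.coe_le_coe, Real.coe_toNNReal _ hC0.le]
      exact hG' n s hs
  obtain ⟨φ₁, hφ₁, v, hvc, hv⟩ := exists_subseq_tendsto_of_lipschitzOnWith (R := max N C) hlip
    fun n s hs => by
      rw [mem_closedBall_zero_iff, Prod.norm_def]
      refine max_le_max ?_ (hGb n s hs)
      rw [Real.norm_eq_abs, abs_of_nonneg (hWb n s hs).1]
      exact (hWb n s hs).2
  obtain ⟨μ, hμ, φ₂, hφ₂, hlamlim⟩ :=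
    (isCompact_Icc (a := a) (b := Λ)).isSeqCompact fun n => hlam (φ₁ n)
  set φ := φ₁ ∘ φ₂ with hφ
  have hφmono : StrictMono φ := hφ₁.comp hφ₂
  have hv' : ∀ s ∈ Icc (0 : ℝ) 1, Tendsto (fun n => (W (φ n) s, G (φ n) s)) atTop (𝓝 (v s)) :=
    fun s hs => (hv s hs).comp hφ₂.tendsto_atTop
  have hWlim : ∀ s ∈ Icc (0 : ℝ) 1, Tendsto (fun n => W (φ n) s) atTop (𝓝 (v s).1) :=
    fun s hs => (continuous_fst.tendsto _).comp (hv' s hs)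
  have hGlim : ∀ s ∈ Icc (0 : ℝ) 1, Tendsto (fun n => G (φ n) s) atTop (𝓝 (v s).2) :=
    fun s hs => (continuous_snd.tendsto _).comp (hv' s hs)
  have hδφ : Tendsto (fun n => δ (φ n)) atTop (𝓝 0) := hδlim.comp hφmono.tendsto_atTop
  have hglim : ∀ s ∈ Icc (0 : ℝ) 1,
      Tendsto (fun n => regPow θ (δ (φ n)) N (W (φ n) s)) atTop (𝓝 ((v s).1 ^ θ)) := by
    intro s hs
    have h1 : Tendsto (fun n => W (φ n) s ^ θ) atTop (𝓝 ((v s).1 ^ θ)) :=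
      (hWlim s hs).rpow_const (Or.inr hθ.le)
    have h2 : Tendsto (fun n => δ (φ n) ^ θ) atTop (𝓝 0) := by
      simpa [Real.zero_rpow hθ.ne'] using hδφ.rpow_const (p := θ) (Or.inr hθ.le)
    have h3 := squeeze_zero_norm (f := fun n => regPow θ (δ (φ n)) N (W (φ n) s) - W (φ n) s ^ θ)
      (fun n => abs_regPow_sub_le hθ hθ1 (hδ (φ n)).1 (hδN (φ n))
      (hWb (φ n) s hs).1 (hWb (φ n) s hs).2) h2
    simpa using h3.add h1
  have h0 : (0 : ℝ) ∈ Icc (0 : ℝ) 1 := ⟨le_rfl, zero_le_one⟩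
  have h1 : (1 : ℝ) ∈ Icc (0 : ℝ) 1 := ⟨zero_le_one, le_rfl⟩
  have hgc : ∀ n, ContinuousOn (fun s => regPow θ (δ (φ n)) N (W (φ n) s)) (Icc 0 1) := fun n => by
    obtain ⟨K, hK⟩ := exists_lipschitzWith_regPow (θ := θ) (hδ (φ n)).1 (hδN (φ n))
    exact hK.continuous.comp_continuousOn (h (φ n)).continuousOn_W
  have hvθ : Continuous fun s => (v s).1 ^ θ := hvc.fst.rpow_const fun _ => Or.inr hθ.le
  have hpow : Continuous fun s : ℝ => (1 - s) ^ σ :=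
    (continuous_const.sub continuous_id).rpow_const fun _ => Or.inr hσ.le
  refine ⟨μ, ha.trans_le hμ.1, fun s => (v s).1, fun s => (v s).2, hvc.fst, hvc.snd, ?_, ?_, ?_,
    fun s hs => ge_of_tendsto' (hWlim s hs) fun n => (hWb (φ n) s hs).1, ⟨s₁, hs₁, hs₁1, ?_⟩,
    fun s hs => ?_, fun s hs => ?_⟩
  · refine tendsto_nhds_unique (hWlim 0 h0) ?_
    simpa only [(h _).W_zero] using hδφ
  · refine tendsto_nhds_unique (hGlim 0 h0) ?_
    simp only [(h _).G_zero, tendsto_const_nhds]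
  · refine tendsto_nhds_unique (hGlim 1 h1) ?_
    simp only [hG1, tendsto_const_nhds]
  · intro s hs
    have hs' : s ∈ Icc (0 : ℝ) 1 := ⟨hs.1.le, hs.2.trans hs₁1⟩
    -- The `δ`-independent lower bound passes to the limit and prevents `W` from vanishing just
    -- after the interface.
    have h2 : (1 - θ) * (b / 4) * s ≤ (v s).1 ^ (1 - θ) :=
      ge_of_tendsto' ((hWlim s hs').rpow_const (Or.inr hθ'.le)) fun n =>
        hlow (φ n) s ⟨hs.1.le, hs.2⟩
    have h3 : 0 ≤ (v s).1 := ge_of_tendsto' (hWlim s hs') fun n => (hWb (φ n) s hs').1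
    refine h3.lt_of_ne fun he => ?_
    rw [← he, Real.zero_rpow hθ'.ne'] at h2
    have := mul_pos (mul_pos hθ' (show 0 < b / 4 by positivity)) hs.1
    linarith
  · refine hasDerivWithinAt_of_tendsto_of_bounded
      (v' := fun s => b * (1 - s) * (v s).1 ^ θ - (v s).2) (fun n => (h (φ n)).hW) (fun n => ?_)
      (fun n => hW' (φ n)) hWlim (fun t ht => ?_) ?_ hs
    · exact (ContinuousOn.mul (by fun_prop) (hgc n)).sub (h (φ n)).continuousOn_G
    · exact ((hglim t ht).const_mul _).sub (hGlim t ht)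
    · exact (Continuous.mul (by fun_prop) hvθ).sub hvc.snd
  · refine hasDerivWithinAt_of_tendsto_of_bounded
      (v' := fun s => (μ * (1 - s) ^ σ - a) * (v s).1 ^ θ) (fun n => (h (φ n)).hG) (fun n => ?_)
      (fun n => hG' (φ n)) hGlim (fun t ht => ?_) ?_ hs
    · exact ContinuousOn.mul ((continuous_const.mul hpow).sub continuous_const).continuousOn
        (hgc n)
    · exact ((hlamlim.mul_const _).sub_const _).mul (hglim t ht)
    · exact ((continuous_const.mul hpow).sub continuous_const).mul hvθ

/-! ### Back to profiles on the half-line -/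

/-- A function `f ≥ 0` is a profile as soon as it satisfies, with its flux `F`, the first order
system `(f ^ m)' = F - β ξ f`, `F' = (α + β - ξ ^ σ) f` on the half-line. -/
theorem isProfile_of_hasDerivWithinAt {m σ : ℝ} {f F : ℝ → ℝ} (hm : 1 < m)
    (hf0 : ∀ ξ, 0 ≤ ξ → 0 ≤ f ξ) (hfc : ContinuousOn f (Ici 0))
    (hf : ∀ ξ, 0 ≤ ξ →
      HasDerivWithinAt (fun x => f x ^ m) (F ξ - betaExp σ * ξ * f ξ) (Ici 0) ξ)
    (hF : ∀ ξ, 0 ≤ ξ →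
      HasDerivWithinAt F ((alphaExp m σ + betaExp σ - ξ ^ σ) * f ξ) (Ici 0) ξ) :
    IsProfile m σ f := by
  have hpow : ∀ ξ, 0 ≤ ξ → powDeriv m f ξ = F ξ - betaExp σ * ξ * f ξ := fun ξ hξ =>
    (hf ξ hξ).derivWithin (uniqueDiffOn_Ici 0 ξ hξ)
  have hFc : ContinuousOn F (Ici 0) := fun ξ hξ => (hF ξ hξ).continuousWithinAt
  refine ⟨hf0, hfc, ?_, fun ξ hξ hpos => ?_, fun ξ hξ => ?_⟩
  · rw [contDiffOn_one_iff_derivWithin (uniqueDiffOn_Ici 0)]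
    refine ⟨fun ξ hξ => (hf ξ hξ).differentiableWithinAt, ?_⟩
    exact (hFc.sub ((continuousOn_const.mul continuousOn_id).mul hfc)).congr hpow
  · have hm0 : m ≠ 0 := by linarith
    -- Where `f > 0`, `f = (f ^ m) ^ (1/m)` inherits differentiability. The pointwise equation is
    -- then the derivative of `(f ^ m)' = F - β ξ f`.
    have hfd : DifferentiableWithinAt ℝ f (Ici 0) ξ := by
      have h1 := (hf ξ hξ).rpow_const (p := 1 / m)
        (Or.inl (Real.rpow_pos_of_pos hpos m).ne')
      refine (h1.congr (f₁ := f) (fun x hx => ?_) ?_).differentiableWithinAt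
      · rw [← Real.rpow_mul (hf0 x hx), mul_one_div_cancel hm0, Real.rpow_one]
      · rw [← Real.rpow_mul hpos.le, mul_one_div_cancel hm0, Real.rpow_one]
    have h2 := ((hF ξ hξ).sub ((((hasDerivWithinAt_id ξ (Ici 0)).const_mul
      (betaExp σ)).mul hfd.hasDerivWithinAt))).congr hpow (hpow ξ hξ)
    refine ⟨hfd, h2.differentiableWithinAt, ?_⟩
    rw [h2.derivWithin (uniqueDiffOn_Ici 0 ξ hξ)]
    simp only [id, mul_one]
    ring
  · refine (hF ξ hξ).congr (fun x hx => ?_) ?_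
    · rw [hpow x hx]; ring
    · rw [hpow ξ hξ]; ring

/-- Extension by zero across `0` of a function with vanishing value and derivative there. -/
theorem hasDerivWithinAt_comp_max {u u' : ℝ → ℝ}
    (h : ∀ s ∈ Icc (0 : ℝ) 1, HasDerivWithinAt u (u' s) (Icc 0 1) s) (h0' : u' 0 = 0) {s : ℝ}
    (hs : s ≤ 1) : HasDerivWithinAt (fun s => u (max s 0)) (u' (max s 0)) (Iic 1) s := by
  rcases lt_trichotomy s 0 with hneg | rfl | hpos
  · rw [max_eq_right hneg.le, h0']
    refine HasDerivAt.hasDerivWithinAt ((hasDerivAt_const s (u 0)).congr_of_eventuallyEq ?_)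
    filter_upwards [Iio_mem_nhds hneg] with t ht
    rw [max_eq_right (le_of_lt ht)]
  · rw [max_self]
    have h1 : HasDerivWithinAt (fun s => u (max s 0)) (u' 0) (Iic 0) 0 := by
      rw [h0']
      refine (hasDerivWithinAt_const (0 : ℝ) (Iic 0) (u 0)).congr (fun t ht => ?_) (by simp)
      rw [max_eq_right ht]
    have h2 : HasDerivWithinAt (fun s => u (max s 0)) (u' 0) (Icc 0 1) 0 :=
      (h 0 ⟨le_rfl, zero_le_one⟩).congr (fun t ht => by rw [max_eq_left ht.1]) (by simp)
    have := h1.union h2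
    rwa [Iic_union_Icc_eq_Iic zero_le_one] at this
  · rw [max_eq_left hpos.le]
    have h2 : HasDerivWithinAt (fun s => u (max s 0)) (u' s) (Icc 0 1) s :=
      (h s ⟨hpos.le, hs⟩).congr (fun t ht => by rw [max_eq_left ht.1]) (by rw [max_eq_left hpos.le])
    refine h2.mono_of_mem_nhdsWithin ?_
    rw [← Ici_inter_Iic]
    exact inter_mem (mem_nhdsWithin_of_mem_nhds (Ici_mem_nhds hpos)) self_mem_nhdsWithin

theorem exists_isGoodProfileWithInterface {m σ : ℝ} (hm : 1 < m) (hσ : 0 < σ) :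
    ∃ f : ℝ → ℝ, IsGoodProfileWithInterface m σ f := by
  have hm0 : 0 < m := by linarith
  have hm1 : 0 < m - 1 := by linarith
  have hβ : 0 < betaExp σ := one_div_pos.2 hσ
  have hα : 0 < alphaExp m σ := div_pos (by linarith) (mul_pos hσ hm1)
  have hθ : 0 < 1 / m := by positivity
  obtain ⟨lam, hlam, W, G, hWc, hGc, hW0, hG0, hG1, hWnn, ⟨s₁, hs₁, hs₁1, hWpos⟩, hW, hG⟩ :=
    exists_degenerate_shot (add_pos hα hβ) hβ hσ hθ ((div_lt_one hm0).2 hm)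
  have hz : (0 : ℝ) ^ m⁻¹ = 0 := Real.zero_rpow (inv_ne_zero hm0.ne')
  obtain ⟨R, hR, hRσ⟩ : ∃ R : ℝ, 0 < R ∧ R ^ σ = lam :=
    ⟨lam ^ (1 / σ), by positivity, by
      rw [← Real.rpow_mul hlam.le, one_div_mul_cancel hσ.ne', Real.rpow_one]⟩
  -- The amplitude for which `f ^ m` and `β ξ f` scale alike under `ξ = R (1 - s)`.
  obtain ⟨c, hc, hcR⟩ : ∃ c : ℝ, 0 < c ∧ c ^ m = c * R ^ 2 :=
    ⟨R ^ (2 / (m - 1)), by positivity, by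
      rw [← Real.rpow_mul hR.le, ← Real.rpow_natCast R 2, ← Real.rpow_add hR]
      congr 1
      push_cast
      field_simp
      ring⟩
  set f : ℝ → ℝ := fun x => c * W (max (1 - x / R) 0) ^ (1 / m) with hfdef
  set F : ℝ → ℝ := fun x => c * R * G (max (1 - x / R) 0) with hFdef
  have hmem : ∀ x, 0 ≤ x → max (1 - x / R) 0 ∈ Icc (0 : ℝ) 1 := fun x hx =>
    ⟨le_max_right _ _, max_le (by linarith [div_nonneg hx hR.le]) zero_le_one⟩
  have hmaps : MapsTo (fun x : ℝ => 1 - x / R) (Ici 0) (Iic 1) := fun x hx => by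
    have : 0 ≤ x / R := div_nonneg hx hR.le
    simpa using this
  have hinner : ∀ x, HasDerivWithinAt (fun x : ℝ => 1 - x / R) (-(1 / R)) (Ici 0) x := fun x =>
    (((hasDerivAt_id x).div_const R).const_sub 1).hasDerivWithinAt
  have hf0 : ∀ x, 0 ≤ x → 0 ≤ f x := fun x hx =>
    mul_nonneg hc.le (Real.rpow_nonneg (hWnn _ (hmem x hx)) _)
  have hfm : ∀ x, 0 ≤ x → f x ^ m = c ^ m * W (max (1 - x / R) 0) := fun x hx => by
    have h1 := hWnn _ (hmem x hx)
    rw [hfdef]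
    simp only
    rw [Real.mul_rpow hc.le (Real.rpow_nonneg h1 _), ← Real.rpow_mul h1,
      one_div_mul_cancel hm0.ne', Real.rpow_one]
  have hfc : Continuous f := continuous_const.mul
    ((hWc.comp (by fun_prop)).rpow_const fun _ => Or.inr hθ.le)
  have hfd : ∀ x, 0 ≤ x →
      HasDerivWithinAt (fun x => f x ^ m) (F x - betaExp σ * x * f x) (Ici 0) x := by
    intro x hx
    have h1 := (((hasDerivWithinAt_comp_max hW (by simp [hW0, hG0, hz]) (hmaps hx)).comp x
      (hinner x) hmaps).const_mul (c ^ m)).congr hfm (hfm x hx)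
    refine h1.congr_deriv ?_
    simp only [hfdef, hFdef, hcR]
    rcases le_total (1 - x / R) 0 with hneg | hpos
    · simp [max_eq_right hneg, hW0, hG0, hz]
    · rw [max_eq_left hpos]
      field_simp
      ring
  have hFd : ∀ x, 0 ≤ x →
      HasDerivWithinAt F ((alphaExp m σ + betaExp σ - x ^ σ) * f x) (Ici 0) x := by
    intro x hx
    have h1 := ((hasDerivWithinAt_comp_max hG (by simp [hW0, hz]) (hmaps hx)).comp x
      (hinner x) hmaps).const_mul (c * R)
    refine h1.congr_deriv ?_
    simp only [hfdef]
    rcases le_total (1 - x / R) 0 with hneg | hpos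
    · simp [max_eq_right hneg, hW0, hz]
    · have h2 : lam * (x / R) ^ σ = x ^ σ := by
        rw [Real.div_rpow hx hR.le, hRσ]; field_simp
      rw [max_eq_left hpos, sub_sub_cancel, h2]
      field_simp
      ring
  have hF0 : F 0 = 0 := by simp [hFdef, hG1]
  have hder0 := hfd 0 le_rfl
  rw [hF0, mul_zero, zero_mul, sub_zero] at hder0
  refine ⟨f, ⟨isProfile_of_hasDerivWithinAt hm hf0 hfc.continuousOn hfd hFd, ?_⟩, R, hR,
    ?_, ?_, s₁ * R, mul_pos hs₁ hR, mul_le_of_le_one_left hR.le hs₁1, fun ξ hξ => ?_⟩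
  -- Zero flux at the origin means `(f^m)'(0) = 0`; when `f 0 > 0`, taking the power `1/m` turns
  -- this into `f'(0) = 0`.
  · rcases (hf0 0 le_rfl).eq_or_lt with h0 | hpos
    · exact Or.inr ⟨h0.symm, hder0⟩
    · refine Or.inl ⟨hpos, ?_⟩
      have h1 := hder0.rpow_const (p := 1 / m) (Or.inl (Real.rpow_pos_of_pos hpos m).ne')
      rw [zero_mul, zero_mul] at h1
      refine h1.congr (fun x hx => ?_) ?_
      · rw [← Real.rpow_mul (hf0 x hx), mul_one_div_cancel hm0.ne', Real.rpow_one]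
      · rw [← Real.rpow_mul hpos.le, mul_one_div_cancel hm0.ne', Real.rpow_one]
  · simp [hfdef, hR.ne', hW0, hz]
  · have h1 := (hfd R hR.le).hasDerivAt (Ici_mem_nhds hR)
    refine h1.congr_deriv ?_
    simp [hfdef, hFdef, hR.ne', hW0, hG0, hz]
  · have h1 : ξ / R < 1 := (div_lt_one hR).2 hξ.2
    have h2 : 1 - s₁ < ξ / R := by rw [lt_div_iff₀ hR]; linarith [hξ.1]
    have h3 : 0 ≤ 1 - ξ / R := by linarith
    simp only [hfdef, max_eq_left h3]
    exact mul_pos hc (Real.rpow_pos_of_pos (hWpos _ ⟨by linarith, by linarith⟩) _)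

/-! ### The explicit profile -/

theorem hasDerivAt_max_zero_rpow {q : ℝ} (hq : 1 < q) (r : ℝ) :
    HasDerivAt (fun r : ℝ => (max r 0) ^ q) (q * (max r 0) ^ (q - 1)) r := by
  have hq0 : q ≠ 0 := by linarith
  have hq1 : q - 1 ≠ 0 := by linarith
  have hpow : ∀ r : ℝ, HasDerivAt (fun r : ℝ => r ^ q) (q * r ^ (q - 1)) r := fun r =>
    Real.hasDerivAt_rpow_const (Or.inr hq.le)
  rcases lt_trichotomy r 0 with hneg | rfl | hpos
  · rw [max_eq_right hneg.le, Real.zero_rpow hq1, mul_zero]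
    refine (hasDerivAt_const r (0 : ℝ)).congr_of_eventuallyEq ?_
    filter_upwards [Iio_mem_nhds hneg] with t ht
    rw [max_eq_right (le_of_lt ht), Real.zero_rpow hq0]
  · rw [max_self, Real.zero_rpow hq1, mul_zero, ← hasDerivWithinAt_univ, ← Iic_union_Ici]
    refine HasDerivWithinAt.union ?_ ?_
    · refine (hasDerivWithinAt_const (0 : ℝ) (Iic 0) (0 : ℝ)).congr (fun t ht => ?_) ?_
      · rw [max_eq_right ht, Real.zero_rpow hq0]
      · simp [hq0]
    · have := (hpow 0).hasDerivWithinAt (s := Ici 0)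
      rw [Real.zero_rpow hq1, mul_zero] at this
      exact this.congr (fun t ht => by rw [max_eq_left ht]) (by simp)
  · rw [max_eq_left hpos.le]
    refine (hpow r).congr_of_eventuallyEq ?_
    filter_upwards [Ioi_mem_nhds hpos] with t ht
    rw [max_eq_left (le_of_lt ht)]

theorem fStar_isGoodProfileWithInterface {m : ℝ} (hm : 1 < m) :
    IsGoodProfileWithInterface m (sigmaStar m) (fStar m) ∧ SatisfiesP2 m (fStar m) := by
  have hm0 : 0 < m := by linarith
  have hm1 : 0 < m - 1 := by linarith
  set S := sigmaStar m with hS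
  have hS2 : S ^ 2 = 2 * (m + 1) := Real.sq_sqrt (by linarith)
  have hS1 : 1 < S := by
    have : 0 ≤ S := Real.sqrt_nonneg _
    nlinarith
  set B := constB m with hB
  have hBpos : 0 < B := by
    rw [hB, constB, ← hS]; positivity
  have hBdef : B * (m * (S + 2) * (m * S + m + 1)) = (m - 1) ^ 2 := by
    rw [hB, constB, ← hS]; field_simp
  set A := (m - 1) / (2 * m * (m + 1)) with hA
  have hApos : 0 < A := by positivity
  have hAdef : A * (m * S ^ 2) = m - 1 := by
    rw [hS2, hA]; field_simp
  set k := 1 / (m - 1) with hk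
  have hk0 : 0 < k := by positivity
  have hkm : k * m = k + 1 := by rw [hk]; field_simp; ring
  have h2k : 2 / (m - 1) = 2 * k := by rw [hk]; ring
  set P : ℝ → ℝ := fun x => max (A - B * x ^ S) 0 with hP
  have hP0 : ∀ x, 0 ≤ P x := fun x => le_max_right _ _
  have hf : ∀ x, fStar m x = x ^ (2 * k) * P x ^ k := fun x => by
    simp only [fStar, h2k, hP, ← hk, ← hA, ← hB, ← hS]
  -- The factor `P ^ k` absorbs the positive part, so the computations below need no case split at
  -- the interface.
  have hPT : ∀ x, P x ^ k * P x = P x ^ k * (A - B * x ^ S) := by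
    intro x
    rcases le_total (A - B * x ^ S) 0 with h | h
    · have : P x = 0 := max_eq_right h
      rw [this, Real.zero_rpow hk0.ne', zero_mul, zero_mul]
    · rw [show P x = A - B * x ^ S from max_eq_left h]
  have hf0 : ∀ x, 0 ≤ x → 0 ≤ fStar m x := fun x hx => by
    rw [hf]; exact mul_nonneg (Real.rpow_nonneg hx _) (Real.rpow_nonneg (hP0 x) _)
  have hxS : ∀ x, HasDerivAt (fun x : ℝ => A - B * x ^ S) (-(B * (S * x ^ (S - 1)))) x := fun x =>
    ((Real.hasDerivAt_rpow_const (Or.inr hS1.le)).const_mul B).const_sub A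
  have hxS1 : ∀ x : ℝ, 0 ≤ x → x ^ (S - 1) * x = x ^ S := fun x hx => by
    rw [← Real.rpow_add_one' hx (by linarith)]; congr 1; ring
  have hPd : ∀ x, HasDerivAt (fun x => P x ^ (k + 1))
      ((k + 1) * P x ^ k * -(B * (S * x ^ (S - 1)))) x := fun x => by
    have := (hasDerivAt_max_zero_rpow (q := k + 1) (by linarith) (A - B * x ^ S)).comp x (hxS x)
    rwa [add_sub_cancel_right] at this
  have hPk1 : ∀ x, P x ^ (k + 1) = P x ^ k * P x := fun x =>
    Real.rpow_add_one' (hP0 x) (by linarith)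
  -- Eliminating `B x ^ S` from `(f^m)'` leaves `C x ^ (2k+1) P ^ (k+1) - k m S A x f`. So the flux
  -- is the first term exactly when `β = k m S A`, which is where `S ^ 2 = 2 (m + 1)` is needed.
  set C := k * m * (S + 2) with hC
  set F : ℝ → ℝ := fun x => C * (x ^ (2 * k + 1) * P x ^ (k + 1)) with hF
  have hβ : betaExp S = k * m * S * A := by
    rw [betaExp, div_eq_iff (by linarith), hk]
    field_simp
    linarith
  have hfd : ∀ x, 0 ≤ x →
      HasDerivWithinAt (fun x => fStar m x ^ m) (F x - betaExp S * x * fStar m x) (Ici 0) x := by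
    intro x hx
    have hfm : ∀ x, 0 ≤ x → fStar m x ^ m = x ^ (2 * k + 2) * P x ^ (k + 1) := fun x hx => by
      rw [hf, Real.mul_rpow (Real.rpow_nonneg hx _) (Real.rpow_nonneg (hP0 x) _),
        ← Real.rpow_mul hx, ← Real.rpow_mul (hP0 x), hkm, mul_assoc, hkm]
      ring_nf
    have h1 := (((Real.hasDerivAt_rpow_const (x := x) (p := 2 * k + 2)
      (Or.inr (by linarith))).mul (hPd x)).hasDerivWithinAt (s := Ici 0)).congr hfm (hfm x hx)
    refine h1.congr_deriv ?_
    have e1 : x ^ (2 * k + 1) = x ^ (2 * k) * x := Real.rpow_add_one' hx (by linarith)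
    have e2 : x ^ (2 * k + 2) = x ^ (2 * k) * x * x := by
      rw [← e1, ← Real.rpow_add_one' hx (by linarith)]; congr 1; ring
    have e3 : 2 * k + 2 - 1 = 2 * k + 1 := by ring
    simp only [hF, hf, e1, e2, e3, hPk1, hPT, hβ, hC, hkm]
    rw [← hxS1 x hx]
    ring
  have hFd : ∀ x, 0 ≤ x →
      HasDerivWithinAt F ((alphaExp m S + betaExp S - x ^ S) * fStar m x) (Ici 0) x := by
    intro x hx
    have h1 := (((Real.hasDerivAt_rpow_const (x := x) (p := 2 * k + 1)
      (Or.inr (by linarith))).mul (hPd x)).const_mul C).hasDerivWithinAt (s := Ici 0)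
    refine h1.congr_deriv ?_
    have e1 : x ^ (2 * k + 1) = x ^ (2 * k) * x := Real.rpow_add_one' hx (by linarith)
    have e3 : 2 * k + 1 - 1 = 2 * k := by ring
    -- Coefficients of `f` and `x ^ S * f` in `F'`; the second identity fixes `B`.
    have c1 : C * ((2 * k + 1) * A) = alphaExp m S + betaExp S := by
      rw [alphaExp, betaExp, hC, hk, hA]
      field_simp
      linear_combination (m + 1) * hS2
    have c2 : C * B * ((2 * k + 1) + (k + 1) * S) = 1 := by
      have : C * B * ((2 * k + 1) + (k + 1) * S) =
          B * (m * (S + 2) * (m * S + m + 1)) / (m - 1) ^ 2 := by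
        rw [hC, hk]; field_simp; ring
      rw [this, hBdef]; field_simp
    simp only [hf, e1, e3, hPk1, hPT]
    have e4 := hxS1 x hx
    linear_combination (x ^ (2 * k) * P x ^ k) * c1 - (x ^ (2 * k) * P x ^ k * x ^ S) * c2 -
      (C * x ^ (2 * k) * (k + 1) * P x ^ k * B * S) * e4
  have hfz : fStar m 0 = 0 := by
    rw [hf, Real.zero_rpow (by linarith), zero_mul]
  have hFz : F 0 = 0 := by
    simp only [hF]
    rw [Real.zero_rpow (by linarith), zero_mul, mul_zero]
  have hfc : ContinuousOn (fStar m) (Ici 0) := by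
    have hx : Continuous fun x : ℝ => x ^ S := continuous_id.rpow_const fun _ => Or.inr (by linarith)
    have h1 : Continuous fun x : ℝ => x ^ (2 * k) * P x ^ k :=
      (continuous_id.rpow_const fun _ => Or.inr (by linarith)).mul
        (((continuous_const.sub (continuous_const.mul hx)).max continuous_const).rpow_const
          fun _ => Or.inr hk0.le)
    exact h1.continuousOn.congr fun x _ => hf x
  have hP2 : SatisfiesP2 m (fStar m) := by
    refine ⟨hfz, ?_⟩
    have := hfd 0 le_rfl
    rwa [hFz, mul_zero, zero_mul, sub_zero] at this
  have hAB : 0 < A / B := by positivity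
  -- The interface is the zero of `A - B x ^ S`.
  set R := (A / B) ^ (1 / S) with hR
  have hR0 : 0 < R := by positivity
  have hRS : B * R ^ S = A := by
    rw [hR, ← Real.rpow_mul hAB.le, one_div_mul_cancel (by linarith), Real.rpow_one]
    field_simp
  have hPR : P R = 0 := by simp [hP, hRS]
  have hfR : fStar m R = 0 := by rw [hf, hPR, Real.zero_rpow hk0.ne', mul_zero]
  refine ⟨⟨⟨isProfile_of_hasDerivWithinAt hm hf0 hfc hfd hFd, Or.inr hP2⟩, R, hR0, hfR, ?_,
    R, hR0, le_rfl, fun ξ hξ => ?_⟩, hP2⟩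
  · refine ((hfd R hR0.le).hasDerivAt (Ici_mem_nhds hR0)).congr_deriv ?_
    simp only [hF]
    rw [hfR, hPR, Real.zero_rpow (by linarith)]
    ring
  · rw [sub_self] at hξ
    have h1 : ξ ^ S < R ^ S := Real.rpow_lt_rpow hξ.1.le hξ.2 (by linarith)
    have h2 : 0 < P ξ := by
      refine lt_max_of_lt_left ?_
      have := mul_lt_mul_of_pos_left h1 hBpos
      linarith
    rw [hf]
    exact mul_pos (Real.rpow_pos_of_pos hξ.1 _) (Real.rpow_pos_of_pos h2 _)

theorem theorem1p1 (m : ℝ) (hm : 1 < m) :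
    (∀ σ : ℝ, 0 < σ → ∃ f : ℝ → ℝ, IsGoodProfileWithInterface m σ f) ∧
    (IsGoodProfileWithInterface m (sigmaStar m) (fStar m) ∧ SatisfiesP2 m (fStar m)) :=
  ⟨fun _ hσ => exists_isGoodProfileWithInterface hm hσ, fStar_isGoodProfileWithInterface hm⟩
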